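/- All norms are Euclidean. Write $\log_+ x=\max\{1,\log x\}$ (with $\log_+0=1$). A differentiable $F:\mathbb R^d\to\mathbb R$ is $H$-smooth if $F(y)\le F(x)+\langle\nabla F(x),y-x\rangle+\frac H2\|y-x\|^2$ for all $x,y$, and $\lambda$-strongly convex if $F(y)\ge F(x)+\langle\nabla F(x),y-x\rangle+\frac\lambda2\|y-x\|^2$ for all $x,y$ (convex if $\lambda=0$). Fix an initial point $x_0\in\mathbb R^d$. Let $\mathcal F_{DB}[H;R]$ (domain-bounded) be the class of $H$-smooth convex $F$ having a minimizer $x^*$ with $\|x_0-x^*\|\le R$, and $\mathcal F_{RB}[H;\Delta]$ (range-bounded) the class of $H$-smooth convex $F$ having a minimizer and satisfying $F(x_0)-\min F\le\Delta$. A stochastic first-order oracle for $F$ with variance bound $\sigma^2$ is given by a function $f:\mathbb R^d\times\mathcal Z\to\mathbb R$, measurable in $z$ and differentiable in $x$, and a probability distribution $\mathcal D$ on $\mathcal Z$ with $F(x)=\mathbb E_{z\sim\mathcal D}f(x;z)$ and $\mathbb E_{z\sim\mathcal D}\|\nabla f(x;z)-\nabla F(x)\|^2\le\sigma^2$ for all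 $x$. Queried at $x$, it draws an independent $z\sim\mathcal D$ and returns $(f(x;z),\nabla f(x;z))$. From it one obtains an oracle for $F+r$, $r$ a known function, by adding $(r(x),\nabla r(x))$ to the answer. AC-SA for an $L$-smooth, $\mu$-strongly convex objective, from $y_0$ with $n$ oracle calls: set $y_0^{ag}=y_0$; for $t=1,\dots,n$ let $\alpha_t=\frac2{t+1}$, $\gamma_t=\frac{4L}{t(t+1)}$, $$y_t^{md}=\tfrac{(1-\alpha_t)(\mu+\gamma_t)}{\gamma_t+(1-\alpha_t^2)\mu}\,y_{t-1}^{ag}+\tfrac{\alpha_t((1-\alpha_t)\mu+\gamma_t)}{\gamma_t+(1-\alpha_t^2)\mu}\,y_{t-1},$$ query the oracle at $y_t^{md}$ to get a stochastic gradient $g_t$, and set $$y_t=\tfrac{\alpha_t\mu}{\mu+\gamma_t}\,y_t^{md}+\tfrac{(1-\alpha_t)\mu+\gamma_t}{\mu+\gamma_t}\,y_{t-1}-\tfrac{\alpha_t}{\mu+\gamma_t}\,g_t,\qquad y_t^{ag}=\alpha_ty_t+(1-\alpha_t)y_{t-1}^{ag};$$ return $y_n^{ag}$. AC-SA$^2$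 with budget $b$ runs AC-SA with $\lfloor b/2\rfloor$ calls and then AC-SA again with $\lfloor b/2\rfloor$ calls from the point just returned. Algorithm 1 (recursive regularization) with subroutine AC-SA$^2$, for an $H'$-smooth, $\lambda$-strongly convex objective $G$, a budget $m$ and the initial point $\hat x_0=x_0$: let $T=\lfloor\log_2\frac{H'}{\lambda}\rfloor$ ($T=0$ if this is negative); for $t=1,\dots,T$ let $\hat x_t$ be the output of AC-SA$^2$ with budget $\lfloor m/T\rfloor$, started at $\hat x_{t-1}$, on $G^{(t-1)}(x)=G(x)+\lambda\sum_{k=1}^{t-1}2^{k-1}\|x-\hat x_k\|^2$, with parameters $L=H'+\lambda\sum_{k=1}^{t-1}2^k$ and $\mu=\lambda+\lambda\sum_{k=1}^{t-1}2^k$; return $\hat x=\hat x_T$. **Corollary.** There are universal constants $c,C>0$ such that the following holds for all $H,R,\epsilon>0$ and $\sigma\ge0$. Let $$\lambda=c\,\min\Big\{\frac{\epsilon}{R},\ \frac{H\epsilon^4}{\sigma^4\log_+^4(\sigma/\epsilon)}\Big\}$$ (the second term is $+\infty$ if $\sigma=0$). Then there is an integer $$0\le m\le C\Big(\sqrt{\tfrac{HR}{\epsilon}}\,\log_+\!\tfrac{HR}{\epsilon}+\tfrac{\sigma^2}{\epsilon^2}\log_+^3\!\tfrac\sigma\epsilon\Big),$$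 depending only on $H,R,\sigma,\epsilon$, such that for every $d$, every $x_0\in\mathbb R^d$, every $F\in\mathcal F_{DB}[H;R]$ and every stochastic first-order oracle for $F$ with variance bound $\sigma^2$, Algorithm 1 with subroutine AC-SA$^2$ and budget $m$, applied to the $(H+\lambda)$-smooth, $\lambda$-strongly convex function $F(x)+\frac\lambda2\|x-x_0\|^2$, makes at most $m$ oracle calls and returns a point $\hat x$ with $\mathbb E\|\nabla F(\hat x)\|\le\epsilon$. Likewise there are universal constants $c,C>0$ such that for all $H,\Delta,\epsilon>0$ and $\sigma\ge0$ the same algorithm, with $$\lambda=c\,\min\Big\{\frac{\epsilon^2}{\Delta},\ \frac{H\epsilon^4}{\sigma^4\log_+^4(\sigma/\epsilon)}\Big\}$$ and a suitable budget $$0\le m\le C\Big(\tfrac{\sqrt{H\Delta}}{\epsilon}\,\log_+\!\tfrac{\sqrt{H\Delta}}{\epsilon}+\tfrac{\sigma^2}{\epsilon^2}\log_+^3\!\tfrac\sigma\epsilon\Big)$$ depending only on $H,\Delta,\sigma,\epsilon$, makes at most $m$ oracle calls and returns $\hat x$ with $\mathbb E\|\nabla F(\hat x)\|\le\epsilon$,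 for every $d$, every $x_0\in\mathbb R^d$, every $F\in\mathcal F_{RB}[H;\Delta]$ and every stochastic first-order oracle for $F$ with variance bound $\sigma^2$. -/

import Mathlib

open MeasureTheory Finset

noncomputable section

/-! ### Programs that interact with an oracle -/

/-- A program that may query an oracle at points of `X`, receives answers in `I` and
eventually returns an element of `α`. The only access to the oracle is through `query`. -/
inductive OracleProg (X I α : Type) : Type
  | ret : α → OracleProg X I α
  | query : X → (I → OracleProg X I α) → OracleProg X I α

/-- Sequential composition: run `p`, then run `k` on the output of `p`. -/
def OracleProg.bind {X I α β : Type} (p : OracleProg X I α) (k : α → OracleProg X I β) :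
    OracleProg X I β :=
  match p with
  | .ret a => k a
  | .query x c => .query x (fun i => (c i).bind k)

/-- Executing a program with a stochastic oracle: queried at `x`, the oracle answers `O x z`,
where `z` is the next unused element of the sample sequence `ω`. The argument `n` is the number
of oracle calls made before; the result is the output together with the number of oracle
calls made in total. -/
def OracleProg.run {X I α : Type} {Z : Type*} (O : X → Z → I) (ω : ℕ → Z) :
    OracleProg X I α → ℕ → α × ℕ
  | .ret a, n => (a, n)
  | .query x c, n => (c (O x (ω n))).run O ω (n + 1)

/-- The Euclidean space `ℝ^d`. -/
abbrev Euc (d : ℕ) : Type := EuclideanSpace ℝ (Fin d)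

/-- Programs with access to a first-order oracle on `ℝ^d`, whose answers consist of a function
value and a gradient. -/
abbrev FOProg (d : ℕ) (α : Type) : Type := OracleProg (Euc d) (ℝ × Euc d) α

/-! ### Function classes and the stochastic first-order oracle -/

/-- `F` is (differentiable,) `H`-smooth and `lam`-strongly convex. -/
structure SmoothStronglyConvex {d : ℕ} (H lam : ℝ) (F : Euc d → ℝ) : Prop where
  differentiable : Differentiable ℝ F
  smooth : ∀ x y, F y ≤ F x + inner ℝ (gradient F x) (y - x) + H / 2 * ‖y - x‖ ^ 2
  strongly_convex : ∀ x y,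
    F x + inner ℝ (gradient F x) (y - x) + lam / 2 * ‖y - x‖ ^ 2 ≤ F y

/-- The class of domain-bounded functions, relative to the initial point `x₀`. -/
def DomainBounded {d : ℕ} (H lam R : ℝ) (x₀ : Euc d) (F : Euc d → ℝ) : Prop :=
  SmoothStronglyConvex H lam F ∧ ∃ xs, (∀ y, F xs ≤ F y) ∧ ‖x₀ - xs‖ ≤ R

/-- The class of range-bounded functions, relative to the initial point `x₀`. -/
def RangeBounded {d : ℕ} (H lam Δ : ℝ) (x₀ : Euc d) (F : Euc d → ℝ) : Prop :=
  SmoothStronglyConvex H lam F ∧ ∃ xs, (∀ y, F xs ≤ F y) ∧ F x₀ - F xs ≤ Δ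

/-- `f` and the distribution `D` specify a stochastic first-order oracle for `F` with variance
bounded by `σ ^ 2`. -/
structure IsStochasticOracle {d : ℕ} {Z : Type*} [MeasurableSpace Z] (F : Euc d → ℝ) (σ : ℝ)
    (f : Euc d → Z → ℝ) (D : Measure Z) : Prop where
  measurable : ∀ x, Measurable (f x)
  differentiable : ∀ z, Differentiable ℝ (fun x => f x z)
  integrable : ∀ x, Integrable (f x) D
  mean : ∀ x, F x = ∫ z, f x z ∂D
  variance : ∀ x,
    ∫⁻ z, ENNReal.ofReal (‖gradient (fun y => f y z) x - gradient F x‖ ^ 2) ∂D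
      ≤ ENNReal.ofReal (σ ^ 2)

/-- The answer of the stochastic first-order oracle at `x` when the sample drawn is `z`. -/
def oracleAnswer {d : ℕ} {Z : Type*} (f : Euc d → Z → ℝ) (x : Euc d) (z : Z) : ℝ × Euc d :=
  (f x z, gradient (fun y => f y z) x)

/-! ### The algorithms

An objective is accessed through a map `O : Euc d → FOProg d (ℝ × Euc d)`, which at a point
returns a stochastic value and gradient of the objective. -/

/-- Access to the original objective: one call to the oracle. -/
def askOracle {d : ℕ} (x : Euc d) : FOProg d (ℝ × Euc d) :=
  .query x .ret

/-- Access to the objective plus a known function `r`. -/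
def addKnown {d : ℕ} (r : Euc d → ℝ) (O : Euc d → FOProg d (ℝ × Euc d)) (x : Euc d) :
    FOProg d (ℝ × Euc d) :=
  (O x).bind fun a => .ret (a.1 + r x, a.2 + gradient r x)

/-- Iteration `t` (counted from `1`) of AC-SA for an `L`-smooth, `μ`-strongly convex objective.
The state `s` is the pair `(x_{t-1}, x_{t-1}^{ag})`, and the result is `(x_t, x_t^{ag})`. -/
def acsaStep {d : ℕ} (L μ : ℝ) (O : Euc d → FOProg d (ℝ × Euc d)) (t : ℕ)
    (s : Euc d × Euc d) : FOProg d (Euc d × Euc d) :=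
  let α : ℝ := 2 / ((t : ℝ) + 1)
  let γ : ℝ := 4 * L / ((t : ℝ) * ((t : ℝ) + 1))
  let xmd : Euc d :=
    ((1 - α) * (μ + γ) / (γ + (1 - α ^ 2) * μ)) • s.2
      + (α * ((1 - α) * μ + γ) / (γ + (1 - α ^ 2) * μ)) • s.1
  (O xmd).bind fun a =>
    let x : Euc d :=
      (α * μ / (μ + γ)) • xmd + (((1 - α) * μ + γ) / (μ + γ)) • s.1 - (α / (μ + γ)) • a.2
    .ret (x, α • x + (1 - α) • s.2)

/-- The first iterations of AC-SA started at `x₀`. -/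
def acsaIter {d : ℕ} (L μ : ℝ) (O : Euc d → FOProg d (ℝ × Euc d)) (x₀ : Euc d) :
    ℕ → FOProg d (Euc d × Euc d)
  | 0 => .ret (x₀, x₀)
  | t + 1 => (acsaIter L μ O x₀ t).bind (acsaStep L μ O (t + 1))

/-- AC-SA with `m` oracle accesses. -/
def acsa {d : ℕ} (L μ : ℝ) (O : Euc d → FOProg d (ℝ × Euc d)) (x₀ : Euc d) (m : ℕ) :
    FOProg d (Euc d) :=
  (acsaIter L μ O x₀ m).bind fun s => .ret s.2

/-- AC-SA²: two consecutive runs of AC-SA, each with half of the `m` oracle accesses. -/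
def acsaSq {d : ℕ} (L μ : ℝ) (O : Euc d → FOProg d (ℝ × Euc d)) (x₀ : Euc d) (m : ℕ) :
    FOProg d (Euc d) :=
  (acsa L μ O x₀ (m / 2)).bind fun x₁ => acsa L μ O x₁ (m / 2)

/-- A subroutine takes a smoothness and a strong convexity parameter, access to an objective,
an initial point and a budget of oracle accesses. -/
abbrev Subroutine (d : ℕ) : Type :=
  ℝ → ℝ → (Euc d → FOProg d (ℝ × Euc d)) → Euc d → ℕ → FOProg d (Euc d)

/-- The number of rounds `T = ⌊log₂ (H / lam)⌋` of recursive regularization. -/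
def numRounds (H lam : ℝ) : ℕ := ⌊Real.logb 2 (H / lam)⌋₊

/-- The regularizer `F^{(t)} - F`, where `xs k` is the output of round `k`. -/
def recReg {d : ℕ} (lam : ℝ) (xs : ℕ → Euc d) (t : ℕ) (x : Euc d) : ℝ :=
  lam * ∑ k ∈ Icc 1 t, 2 ^ (k - 1) * ‖x - xs k‖ ^ 2

/-- The first rounds of recursive regularization, with budget `b` per round. In round `t + 1`
the subroutine is applied to `F^{(t)}`, which is `(H + lam * ∑_{k=1}^t 2^k)`-smooth and
`(lam + lam * ∑_{k=1}^t 2^k)`-strongly convex, and initialized at the output of round `t`. -/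
def metaIter {d : ℕ} (A : Subroutine d) (H lam : ℝ) (O : Euc d → FOProg d (ℝ × Euc d))
    (x₀ : Euc d) (b : ℕ) : ℕ → FOProg d (ℕ → Euc d)
  | 0 => .ret (fun _ => x₀)
  | t + 1 => (metaIter A H lam O x₀ b t).bind fun xs =>
      (A (H + lam * ∑ k ∈ Icc 1 t, 2 ^ k) (lam + lam * ∑ k ∈ Icc 1 t, 2 ^ k)
        (addKnown (recReg lam xs t) O) (xs t) b).bind fun y =>
          .ret (Function.update xs (t + 1) y)

/-- The recursive regularization meta-algorithm with subroutine `A` for an `H`-smooth,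
`lam`-strongly convex objective, with `m` oracle accesses. -/
def metaAlgorithm {d : ℕ} (A : Subroutine d) (H lam : ℝ) (O : Euc d → FOProg d (ℝ × Euc d))
    (x₀ : Euc d) (m : ℕ) : FOProg d (Euc d) :=
  (metaIter A H lam O x₀ (m / numRounds H lam) (numRounds H lam)).bind
    fun xs => .ret (xs (numRounds H lam))

/-- Recursive regularization with AC-SA² applied to the `(H + lam)`-smooth, `lam`-strongly
convex objective `F(x) + (lam / 2) ‖x - x₀‖ ^ 2`, given an oracle for the `H`-smooth convex
function `F`. -/
def regularizedAlgorithm {d : ℕ} (H lam : ℝ) (x₀ : Euc d) (m : ℕ) : FOProg d (Euc d) :=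
  metaAlgorithm acsaSq (H + lam) lam
    (addKnown (fun x => lam / 2 * ‖x - x₀‖ ^ 2) askOracle) x₀ m

/-! ### The guarantee -/

/-- Run with the stochastic oracle given by `f` and independent samples from `D`, the program
`p` makes at most `m` oracle calls, whatever the samples are, and outputs a point at which
the expected norm of the gradient of `F` is (well defined and) at most `ε`. -/
def FindsStationary {d : ℕ} {Z : Type*} [MeasurableSpace Z] (F : Euc d → ℝ)
    (f : Euc d → Z → ℝ) (D : Measure Z) [IsProbabilityMeasure D] (ε : ℝ) (m : ℕ)
    (p : FOProg d (Euc d)) : Prop :=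
  (∀ ω : ℕ → Z, (p.run (oracleAnswer f) ω 0).2 ≤ m) ∧
  Integrable (fun ω : ℕ → Z => ‖gradient F (p.run (oracleAnswer f) ω 0).1‖)
    (Measure.infinitePi fun _ : ℕ => D) ∧
  ∫ ω : ℕ → Z, ‖gradient F (p.run (oracleAnswer f) ω 0).1‖
    ∂(Measure.infinitePi fun _ : ℕ => D) ≤ ε

/-- The logarithm, bounded below by `1`: the usual reading of logarithmic factors in
complexity bounds. -/
def logp (x : ℝ) : ℝ := max 1 (Real.log x)

end

noncomputable section

/-! ### The budget -/

/-! Write `G = F + lam/2 ‖x - x₀‖²` and let `z_t` minimize `G^{(t)} = G + recReg lam xs t`, with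
`x_1, ..., x_t` the outputs so far. At `z_t` the gradient of `G` is `-∑ lam 2^k (z_t - x_k)`. Once
`2^(t+1) lam` reaches the smoothness constant of `G`, smoothness therefore bounds `‖∇G(x_t)‖` by
`lam` times the potential `∑_{k≤t} 2^k ‖z_t - x_k‖ + 3 * 2^t ‖x_t - z_t‖`
(`norm_gradient_le_metaPotential`).

A new output `y` moves the minimizer by at most `2 ‖y - z_t‖`, so the new potential is at most the
old sum plus `6 * 2^(t+1) ‖y - z_t‖` (`metaPotential_update_le`). In that round the objective has
strong convexity at least `lam 2^t` and smoothness at most twice that of `G`. With enough steps,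
AC-SA² gives `E‖y - z_t‖ ≤ ‖x_t - z_t‖/4 + noise` (`expect_acsaSq_le`), and the factor `1/4` turns
`6 * 2^(t+1)` into the `3 * 2^t` already present. The expected potential thus grows only by the
noise, the same amount in each round (`expect_metaIter_le`). The start contributes `3 ‖x₀ - z_0‖`,
and passing from `G` back to `F` costs `lam ‖x - x₀‖`; the choice of `lam` makes both small.

AC-SA is analysed by a Lyapunov function whose increment per step has expectation at most `4σ²/μ`.
This needs unbiased stochastic gradients, while the oracle only promises unbiased values;
unbiasedness follows by differentiating under the expectation, the variance bound supplying uniform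
integrability of difference quotients.

Expectations of programs are iterated lower integrals (`OracleProg.expect`), for which upper bounds
need no measurability of the intermediate programs. They dominate the expectation over the sample
sequence (`lintegral_run_le_expect`); measurability of the output enters only at the end, for
integrability. -/

lemma one_le_logp (x : ℝ) : 1 ≤ logp x := le_max_left _ _

lemma log_le_logp (x : ℝ) : Real.log x ≤ logp x := le_max_right _ _

lemma natFloor_logb_two_le {M : ℝ} (hM : 1 ≤ 400 * M) :
    (⌊Real.logb 2 (1 + 400 * M)⌋₊ : ℝ) ≤ 2 * (10 + Real.log M) := by
  have hM0 : 0 < M := by linarith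
  have h0 : 0 ≤ Real.log (1 + 400 * M) := Real.log_nonneg (by linarith)
  have hl2 : (1 : ℝ) / 2 < Real.log 2 := by linarith [Real.log_two_gt_d9]
  have h1 : Real.logb 2 (1 + 400 * M) ≤ 2 * Real.log (1 + 400 * M) := by
    rw [Real.logb, div_le_iff₀ (by linarith)]
    nlinarith
  have h2 : Real.log (1 + 400 * M) ≤ 10 + Real.log M := by
    -- Since `1 ≤ 400 M`, the argument is at most `800 M ≤ 1024 M`.
    have h3 : Real.log (1 + 400 * M) ≤ Real.log (2 ^ 10 * M) :=
      Real.log_le_log (by linarith) (by norm_num; linarith)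
    rw [Real.log_mul (by norm_num) hM0.ne', Real.log_pow] at h3
    have := Real.log_two_lt_d9
    push_cast at h3
    linarith
  calc (⌊Real.logb 2 (1 + 400 * M)⌋₊ : ℝ) ≤ Real.logb 2 (1 + 400 * M) :=
        Nat.floor_le (Real.logb_nonneg (by norm_num) (by linarith))
    _ ≤ _ := by linarith

/-- When `s` is small compared to `a`, a factor `logp a ^ 3` on `s ^ 2` can be traded. -/
lemma logp_cube_mul_sq_le {a s : ℝ} (ha : 0 < a) (hs : 0 ≤ s) :
    logp a ^ 3 * s ^ 2 ≤ 64 * (a * logp a + s ^ 2 * logp s ^ 3) := by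
  have hla := one_le_logp a
  have hls := one_le_logp s
  rcases le_or_gt (logp a) (4 * logp s) with h | h
  · have h3 : logp a ^ 3 ≤ (4 * logp s) ^ 3 := pow_le_pow_left₀ (by linarith) h 3
    have h4 := mul_le_mul_of_nonneg_right h3 (sq_nonneg s)
    have : 0 ≤ a * logp a := by positivity
    nlinarith
  · have ha4 : logp a = Real.log a := by
      have h5 : (1 : ℝ) < logp a := by linarith
      rw [logp] at h5 ⊢
      rcases lt_max_iff.1 h5 with h6 | h6
      · exact absurd h6 (lt_irrefl _)
      · exact max_eq_right h6.le
    -- Here `a = exp y` and `s ≤ exp (y/4)`, so `y² s²` is at most a constant times `exp (y/2) * exp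
    -- (y/2) = a`.
    set y := logp a with hy
    have hea : Real.exp y = a := by rw [ha4, Real.exp_log ha]
    have hsy : s ^ 2 ≤ Real.exp (y / 2) := by
      have h6 : s ≤ Real.exp (y / 4) := by
        rcases hs.eq_or_lt with h0 | h0
        · rw [← h0]; positivity
        · rw [← Real.log_le_iff_le_exp h0]
          linarith [log_le_logp s]
      calc s ^ 2 ≤ Real.exp (y / 4) ^ 2 := pow_le_pow_left₀ hs h6 2
        _ = Real.exp (y / 2) := by rw [← Real.exp_nat_mul]; congr 1; push_cast; ring
    have hq : y ^ 2 ≤ 8 * Real.exp (y / 2) := by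
      have := Real.quadratic_le_exp_of_nonneg (x := y / 2) (by linarith)
      nlinarith
    have h7 : y ^ 2 * s ^ 2 ≤ 8 * a := by
      calc y ^ 2 * s ^ 2 ≤ (8 * Real.exp (y / 2)) * Real.exp (y / 2) :=
            mul_le_mul hq hsy (sq_nonneg s) (by positivity)
        _ = 8 * a := by rw [mul_assoc, ← Real.exp_add, add_halves, hea]
    have h8 : y * (y ^ 2 * s ^ 2) ≤ y * (8 * a) := mul_le_mul_of_nonneg_left h7 (by linarith)
    have : 0 ≤ s ^ 2 * logp s ^ 3 := by positivity
    nlinarith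

/-- Here `Q` is the condition number of the regularized objective, `T` the number of rounds and `n`
the length of one AC-SA run. Of the two ceilings in `n`, the first makes each round contract and the
second averages out the noise of all `T` rounds. The total is of order `T √Q + T³ s²`, and `T` is
logarithmic in `Q`. -/
lemma budget_le {A s Q : ℝ} {T n : ℕ} (hA : 0 < A) (hs : 0 ≤ s)
    (hQ : Q = 1 + 400 * max A (s ^ 4 * logp s ^ 4)) (hT : T = ⌊Real.logb 2 Q⌋₊)
    (hn : n = ⌈Real.sqrt (32 * Q)⌉₊ + ⌈(192 * T * s) ^ 2⌉₊ + 1) :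
    ((2 * n * T : ℕ) : ℝ)
      ≤ 10 ^ 12 * (Real.sqrt A * logp (Real.sqrt A) + s ^ 2 * logp s ^ 3) := by
  set M := max A (s ^ 4 * logp s ^ 4) with hM
  set a := Real.sqrt A with ha
  have ha0 : 0 < a := Real.sqrt_pos.2 hA
  have haA : a ^ 2 = A := Real.sq_sqrt hA.le
  have hls := one_le_logp s
  have hla := one_le_logp a
  have hM0 : 0 < M := lt_of_lt_of_le hA (le_max_left _ _)
  have hrhs : 0 ≤ a * logp a + s ^ 2 * logp s ^ 3 := by positivity
  rcases Nat.eq_zero_or_pos T with h0 | hTpos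
  · rw [h0]; simp only [mul_zero, Nat.cast_zero]; positivity
  -- At least one round means `Q ≥ 2`.
  have hM1 : 1 ≤ 400 * M := by
    by_contra hlt
    have : Real.logb 2 Q < 1 := by
      rw [Real.logb_lt_iff_lt_rpow (by norm_num) (by rw [hQ]; positivity)]
      rw [hQ]; norm_num; linarith
    have : T < 1 := by rw [hT]; exact (Nat.floor_lt' one_ne_zero).2 (by simpa using this)
    omega
  have hTM : (T : ℝ) ≤ 2 * (10 + Real.log M) := by
    rw [hT, hQ]; exact natFloor_logb_two_le hM1
  have hT1 : (1 : ℝ) ≤ T := by exact_mod_cast hTpos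
  set q := Real.sqrt M with hq
  have hq0 : 0 < q := Real.sqrt_pos.2 hM0
  have hqM : q ^ 2 = M := Real.sq_sqrt hM0.le
  have hq1 : 1 ≤ 20 * q := by nlinarith
  have hsq : Real.sqrt (32 * Q) ≤ 160 * q :=
    Real.sqrt_le_iff.2 ⟨by positivity, by rw [hQ]; nlinarith⟩
  -- Rounding adds three units, at most `60 q` because `1 ≤ 20 q`; and `36864 = 192²`.
  have hnle : (n : ℝ) ≤ 220 * q + 36864 * (T ^ 2 * s ^ 2) := by
    have h1 := (Nat.ceil_lt_add_one (Real.sqrt_nonneg (32 * Q))).le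
    have h2 := (Nat.ceil_lt_add_one (sq_nonneg (192 * (T : ℝ) * s))).le
    rw [hn]; push_cast
    nlinarith
  have hm : ((2 * n * T : ℕ) : ℝ) ≤ 440 * (T * q) + 73728 * (T ^ 3 * s ^ 2) := by
    push_cast
    have := mul_le_mul_of_nonneg_right hnle (by positivity : (0 : ℝ) ≤ 2 * T)
    nlinarith
  suffices hmain : T * q ≤ 36 * (a * logp a + s ^ 2 * logp s ^ 3) ∧
      T ^ 3 * s ^ 2 ≤ 36 ^ 3 * 64 * (a * logp a + s ^ 2 * logp s ^ 3) by
    obtain ⟨h1, h2⟩ := hmain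
    refine hm.trans ?_
    nlinarith
  -- If `A` dominates, `T` is of order `logp a`, and `logp_cube_mul_sq_le` absorbs the mismatched
  -- logarithm in `T³ s²`. Otherwise `√M = s² logp² s` and `T` is of order `logp s`, so both
  -- products are of order `s² logp³ s`.
  rcases le_total (s ^ 4 * logp s ^ 4) A with hBA | hAB
  · have hMA : M = A := max_eq_left hBA
    have hqa : q = a := by rw [hq, hMA]
    have hT2 : (T : ℝ) ≤ 36 * logp a := by
      rw [hMA, ← haA, Real.log_pow] at hTM
      push_cast at hTM
      linarith [log_le_logp a]
    constructor
    · rw [hqa]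
      have := mul_le_mul_of_nonneg_right hT2 ha0.le
      have : 0 ≤ s ^ 2 * logp s ^ 3 := by positivity
      nlinarith
    · have h3 : (T : ℝ) ^ 3 ≤ (36 * logp a) ^ 3 := pow_le_pow_left₀ (by positivity) hT2 3
      have h4 := mul_le_mul_of_nonneg_right h3 (sq_nonneg s)
      have h5 := logp_cube_mul_sq_le ha0 hs
      calc (T : ℝ) ^ 3 * s ^ 2 ≤ 36 ^ 3 * (logp a ^ 3 * s ^ 2) := by rw [mul_pow] at h4; linarith
        _ ≤ _ := by linarith
  · have hMB : M = s ^ 4 * logp s ^ 4 := max_eq_right hAB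
    have hs0 : 0 < s := by
      rcases hs.eq_or_lt with h | h
      · rw [← h] at hAB; norm_num at hAB; linarith
      · exact h
    have hqs : q = s ^ 2 * logp s ^ 2 := by
      rw [hq, hMB, show s ^ 4 * logp s ^ 4 = (s ^ 2 * logp s ^ 2) ^ 2 by ring]
      exact Real.sqrt_sq (by positivity)
    have hT2 : (T : ℝ) ≤ 36 * logp s := by
      rw [hMB, Real.log_mul (by positivity) (by positivity), Real.log_pow, Real.log_pow] at hTM
      push_cast at hTM
      have := Real.log_le_sub_one_of_pos (x := logp s) (by linarith)
      linarith [log_le_logp s]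
    have hal : 0 ≤ a * logp a := by positivity
    constructor
    · rw [hqs]
      have := mul_le_mul_of_nonneg_right hT2 (by positivity : 0 ≤ s ^ 2 * logp s ^ 2)
      nlinarith
    · have h3 : (T : ℝ) ^ 3 ≤ (36 * logp s) ^ 3 := pow_le_pow_left₀ (by positivity) hT2 3
      have h4 := mul_le_mul_of_nonneg_right h3 (sq_nonneg s)
      have h5 : 0 ≤ s ^ 2 * logp s ^ 3 := by positivity
      nlinarith

/-! ### Smooth strongly convex functions -/

section SmoothStronglyConvex

variable {d : ℕ}

lemma hasGradientAt_mul_norm_sub_sq (c : ℝ) (p x : Euc d) :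
    HasGradientAt (fun y => c * ‖y - p‖ ^ 2) ((2 * c) • (x - p)) x := by
  rw [hasGradientAt_iff_hasFDerivAt]
  have h := ((hasFDerivAt_id x).sub_const p).norm_sq.const_mul c
  refine h.congr_fderiv ?_
  ext v
  simp
  ring

lemma HasGradientAt.add_fun {F G : Euc d → ℝ} {u v x : Euc d} (hF : HasGradientAt F u x)
    (hG : HasGradientAt G v x) : HasGradientAt (fun y => F y + G y) (u + v) x := by
  rw [hasGradientAt_iff_hasFDerivAt] at *
  rw [map_add]
  exact hF.add hG

lemma gradient_eq_zero_of_forall_le {F : Euc d → ℝ} {xs : Euc d} (hm : ∀ y, F xs ≤ F y) :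
    gradient F xs = 0 := by
  have h1 : IsLocalMin F xs := Filter.Eventually.of_forall hm
  rw [gradient, h1.fderiv_eq_zero, map_zero]

namespace SmoothStronglyConvex

variable {H lam : ℝ} {F : Euc d → ℝ}

lemma hasGradientAt (h : SmoothStronglyConvex H lam F) (x : Euc d) :
    HasGradientAt F (gradient F x) x := (h.differentiable x).hasGradientAt

/-- Adding a quadratic increases both parameters. -/
lemma add_sq (h : SmoothStronglyConvex H lam F) (c : ℝ) (p : Euc d) :
    SmoothStronglyConvex (H + 2 * c) (lam + 2 * c) (fun x => F x + c * ‖x - p‖ ^ 2) := by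
  have hg : ∀ x, HasGradientAt (fun x => F x + c * ‖x - p‖ ^ 2)
      (gradient F x + (2 * c) • (x - p)) x :=
    fun x => (h.hasGradientAt x).add_fun (hasGradientAt_mul_norm_sub_sq c p x)
  have hid : ∀ x y : Euc d, c * ‖y - p‖ ^ 2
      = c * ‖x - p‖ ^ 2 + inner ℝ ((2 * c) • (x - p)) (y - x) + c * ‖y - x‖ ^ 2 := by
    intro x y
    have : y - p = (x - p) + (y - x) := by abel
    rw [this, norm_add_sq_real, inner_smul_left]
    simp
    ring
  refine ⟨fun x => (hg x).differentiableAt, fun x y => ?_, fun x y => ?_⟩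
  · rw [(hg x).gradient, inner_add_left, hid x y]
    have := h.smooth x y
    linarith
  · rw [(hg x).gradient, inner_add_left, hid x y]
    have := h.strongly_convex x y
    linarith

lemma monotone_gradient (h : SmoothStronglyConvex H lam F) (x y : Euc d) :
    lam * ‖x - y‖ ^ 2 ≤ inner ℝ (gradient F x - gradient F y) (x - y) := by
  have h1 := h.strongly_convex x y
  have h2 := h.strongly_convex y x
  rw [norm_sub_rev y x, ← neg_sub x y, inner_neg_right] at h1
  rw [inner_sub_left]
  linarith

lemma mul_norm_sub_le (h : SmoothStronglyConvex H lam F) (x y : Euc d) :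
    lam * ‖x - y‖ ≤ ‖gradient F x - gradient F y‖ := by
  rcases (norm_nonneg (x - y)).eq_or_lt with h0 | h0
  · rw [← h0]; simp
  · have h1 := (h.monotone_gradient x y).trans (real_inner_le_norm _ _)
    rw [pow_two, ← mul_assoc] at h1
    exact le_of_mul_le_mul_right h1 h0

lemma half_mul_norm_sub_sq_le (h : SmoothStronglyConvex H lam F) {xs : Euc d}
    (hm : ∀ y, F xs ≤ F y) (y : Euc d) : lam / 2 * ‖y - xs‖ ^ 2 ≤ F y - F xs := by
  have h1 := h.strongly_convex xs y
  rw [gradient_eq_zero_of_forall_le hm, inner_zero_left] at h1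
  linarith

/-- The gradient of a smooth convex function satisfies a quadratic lower bound. -/
lemma norm_gradient_sub_sq_le (h : SmoothStronglyConvex H lam F) (hH : 0 < H) (hl : 0 ≤ lam)
    (x y : Euc d) : 1 / (2 * H) * ‖gradient F y - gradient F x‖ ^ 2
      ≤ F y - F x - inner ℝ (gradient F x) (y - x) := by
  set g := gradient F y - gradient F x with hg
  -- Convexity at `x` and smoothness at `y` are compared at the point `w` that minimizes the
  -- difference of the two bounds when `lam = 0`.
  set w := y - H⁻¹ • g with hw
  have h1 := h.strongly_convex x w
  have h2 := h.smooth y w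
  have hwy : w - y = -(H⁻¹ • g) := by rw [hw]; abel
  have hwx : w - x = (y - x) - H⁻¹ • g := by rw [hw]; abel
  rw [hwy, norm_neg, norm_smul, inner_neg_right, inner_smul_right, mul_pow, Real.norm_eq_abs,
    sq_abs] at h2
  have h3 : 0 ≤ lam / 2 * ‖w - x‖ ^ 2 := by positivity
  rw [hwx, inner_sub_right, inner_smul_right] at h1
  have h4 : inner ℝ (gradient F y) g - inner ℝ (gradient F x) g = ‖g‖ ^ 2 := by
    rw [← inner_sub_left, ← hg, real_inner_self_eq_norm_sq]
  have h5 : H / 2 * (H⁻¹ ^ 2 * ‖g‖ ^ 2) = 1 / (2 * H) * ‖g‖ ^ 2 := by field_simp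
  have h6 : H⁻¹ * ‖g‖ ^ 2 = 2 * (1 / (2 * H) * ‖g‖ ^ 2) := by field_simp
  have h7 : H⁻¹ * inner ℝ (gradient F y) g - H⁻¹ * inner ℝ (gradient F x) g
      = H⁻¹ * ‖g‖ ^ 2 := by rw [← mul_sub, h4]
  rw [← hwx] at h1
  linarith

lemma norm_gradient_sub_le (h : SmoothStronglyConvex H lam F) (hH : 0 < H) (hl : 0 ≤ lam)
    (x y : Euc d) : ‖gradient F x - gradient F y‖ ≤ H * ‖x - y‖ := by
  have h1 := h.norm_gradient_sub_sq_le hH hl x y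
  have h2 := h.norm_gradient_sub_sq_le hH hl y x
  have h3 := real_inner_le_norm (gradient F x - gradient F y) (x - y)
  rw [norm_sub_rev (gradient F y)] at h1
  rw [← neg_sub x y, inner_neg_right] at h1
  rw [inner_sub_left] at h3
  set a := ‖gradient F x - gradient F y‖
  -- The two quadratic bounds, with `x` and `y` exchanged, add up to cocoercivity of the gradient;
  -- Cauchy–Schwarz finishes.
  have h4 : 1 / H * a ^ 2 ≤ a * ‖x - y‖ := by
    have : 1 / H * a ^ 2 = 2 * (1 / (2 * H) * a ^ 2) := by field_simp
    linarith
  rcases (norm_nonneg (gradient F x - gradient F y)).eq_or_lt with h0 | h0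
  · change 0 = a at h0
    rw [← h0]; positivity
  · change 0 < a at h0
    rw [div_mul_eq_mul_div, one_mul, div_le_iff₀ hH] at h4
    nlinarith

lemma continuous_gradient (h : SmoothStronglyConvex H lam F) (hH : 0 < H) (hl : 0 ≤ lam) :
    Continuous (gradient F) := by
  refine (LipschitzWith.of_dist_le_mul (K := H.toNNReal) fun x y => ?_).continuous
  rw [dist_eq_norm, dist_eq_norm, Real.coe_toNNReal _ hH.le]
  exact h.norm_gradient_sub_le hH hl x y

lemma exists_minimizer (h : SmoothStronglyConvex H lam F) (hl : 0 < lam) :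
    ∃ xs, ∀ y, F xs ≤ F y := by
  refine h.differentiable.continuous.exists_forall_le ?_
  set g := ‖gradient F 0‖ with hg
  -- Coercivity: half of the quadratic term absorbs the linear one, by Young's inequality.
  have hlow : ∀ y : Euc d, F 0 - g ^ 2 / lam + lam / 4 * ‖y‖ ^ 2 ≤ F y := by
    intro y
    have h1 := h.strongly_convex 0 y
    have h2 := neg_le_of_abs_le (abs_real_inner_le_norm (gradient F 0) (y - 0))
    rw [sub_zero, ← hg] at *
    have h3 : 0 ≤ (lam / 2 * ‖y‖ - g) ^ 2 / lam := by positivity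
    have h4 : (lam / 2 * ‖y‖ - g) ^ 2 / lam
        = lam / 4 * ‖y‖ ^ 2 - g * ‖y‖ + g ^ 2 / lam := by field_simp; ring
    linarith
  refine Filter.tendsto_atTop_mono hlow (Filter.tendsto_atTop_add_const_left _ _ ?_)
  refine Filter.Tendsto.const_mul_atTop (by positivity) ?_
  exact (Filter.tendsto_pow_atTop two_ne_zero).comp (tendsto_norm_cocompact_atTop)

end SmoothStronglyConvex

/-! ### The regularizers -/

lemma recReg_zero (lam : ℝ) (xs : ℕ → Euc d) (x : Euc d) : recReg lam xs 0 x = 0 := by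
  simp [recReg]

lemma recReg_succ (lam : ℝ) (xs : ℕ → Euc d) (t : ℕ) (x : Euc d) :
    recReg lam xs (t + 1) x = recReg lam xs t x + lam * 2 ^ t * ‖x - xs (t + 1)‖ ^ 2 := by
  simp only [recReg]
  rw [Finset.sum_Icc_succ_top (by omega), Nat.add_sub_cancel]
  ring

lemma recReg_congr {lam : ℝ} {xs ys : ℕ → Euc d} {t : ℕ} (h : ∀ k ∈ Icc 1 t, xs k = ys k) :
    recReg lam xs t = recReg lam ys t := by
  funext x
  simp only [recReg]
  congr 1
  exact Finset.sum_congr rfl fun k hk => by rw [h k hk]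

lemma hasGradientAt_recReg (lam : ℝ) (xs : ℕ → Euc d) (t : ℕ) (x : Euc d) :
    HasGradientAt (recReg lam xs t) (∑ k ∈ Icc 1 t, (lam * 2 ^ k) • (x - xs k)) x := by
  induction t with
  | zero =>
    have : recReg lam xs 0 = fun _ => 0 := funext fun x => recReg_zero lam xs x
    rw [this]
    simpa using hasGradientAt_const x (0 : ℝ)
  | succ t ih =>
    have : recReg lam xs (t + 1)
        = fun x => recReg lam xs t x + lam * 2 ^ t * ‖x - xs (t + 1)‖ ^ 2 :=
      funext fun x => recReg_succ lam xs t x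
    rw [this, Finset.sum_Icc_succ_top (by omega)]
    convert! ih.add_fun (hasGradientAt_mul_norm_sub_sq (lam * 2 ^ t) (xs (t + 1)) x) using 3
    ring

lemma SmoothStronglyConvex.add_recReg {H mu : ℝ} {F : Euc d → ℝ}
    (h : SmoothStronglyConvex H mu F) (lam : ℝ) (xs : ℕ → Euc d) (t : ℕ) :
    SmoothStronglyConvex (H + lam * ∑ k ∈ Icc 1 t, 2 ^ k) (mu + lam * ∑ k ∈ Icc 1 t, 2 ^ k)
      (fun x => F x + recReg lam xs t x) := by
  induction t with
  | zero => simpa [recReg_zero] using h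
  | succ t ih =>
    have h1 := ih.add_sq (lam * 2 ^ t) (xs (t + 1))
    simp only [recReg_succ, Finset.sum_Icc_succ_top (Nat.le_add_left 1 t)]
    convert! h1 using 1
    · ring
    · ring
    · funext x; ring

lemma sum_Icc_two_pow (t : ℕ) : ∑ k ∈ Icc 1 t, (2 : ℝ) ^ k = 2 ^ (t + 1) - 2 := by
  induction t with
  | zero => simp
  | succ t ih => rw [Finset.sum_Icc_succ_top (by omega), ih]; ring

end SmoothStronglyConvex

/-! ### Expectations of programs -/

/-- The first sample is independent of the later ones, which are distributed like the whole
sequence. -/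
lemma lintegral_infinitePi_nat_le {Z : Type*} [MeasurableSpace Z] (D : Measure Z)
    [IsProbabilityMeasure D] (g : (ℕ → Z) → ENNReal) :
    ∫⁻ ω, g ω ∂(Measure.infinitePi fun _ : ℕ => D)
      ≤ ∫⁻ z, ∫⁻ ω, g (Nat.rec z fun n _ => ω n) ∂(Measure.infinitePi fun _ : ℕ => D) ∂D := by
  set P := Measure.infinitePi fun _ : ℕ => D with hP
  let e : Z × (ℕ → Z) ≃ᵐ (ℕ → Z) :=
    { toFun := fun y => Nat.rec y.1 fun n _ => y.2 n
      invFun := fun ω => (ω 0, fun n => ω (n + 1))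
      left_inv := fun y => rfl
      right_inv := fun ω => by funext n; cases n <;> rfl
      measurable_toFun := by
        refine measurable_pi_lambda _ fun n => ?_
        cases n with
        | zero => exact measurable_fst
        | succ n => exact (measurable_pi_apply n).comp measurable_snd
      measurable_invFun := by
        refine (measurable_pi_apply 0).prodMk (measurable_pi_lambda _ fun n => ?_)
        exact measurable_pi_apply (n + 1) }
  have hmap : (D.prod P).map e = P := by
    refine Measure.eq_infinitePi _ fun s t ht => ?_
    obtain ⟨N, hN⟩ := s.exists_nat_subset_range
    -- Padding by `univ` lets the cylinder constrain an initial segment of coordinates, which the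
    -- shift maps to an initial segment.
    let t' : ℕ → Set Z := fun i => if i ∈ s then t i else Set.univ
    have ht' : ∀ i, MeasurableSet (t' i) := fun i => by
      simp only [t']; split_ifs
      · exact ht i
      · exact .univ
    have h1 : e ⁻¹' (Set.pi s t)
        = t' 0 ×ˢ Set.pi (Finset.range N : Set ℕ) (fun i => t' (i + 1)) := by
      ext y
      simp only [Set.mem_preimage, Set.mem_pi, Set.mem_prod, t', Finset.mem_coe]
      constructor
      · intro h
        refine ⟨?_, fun i _ => ?_⟩
        · split_ifs with h0
          · exact h 0 h0
          · trivial
        · split_ifs with h0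
          · exact h (i + 1) h0
          · trivial
      · rintro ⟨h0, h2⟩ i hi
        cases i with
        | zero => rw [if_pos hi] at h0; exact h0
        | succ i =>
          have h3 := h2 i (by have := Finset.mem_range.1 (hN hi); exact Finset.mem_range.2 (by omega))
          rw [if_pos hi] at h3
          exact h3
    rw [e.map_apply, h1, Measure.prod_prod, hP, Measure.infinitePi_pi _ fun i _ => ht' (i + 1)]
    rw [mul_comm, ← Finset.prod_range_succ' (fun i => D (t' i)) N]
    have hsub : s ⊆ Finset.range (N + 1) := hN.trans (Finset.range_mono (by omega))
    rw [← Finset.prod_subset hsub fun i _ hi => by simp [t', hi]]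
    exact Finset.prod_congr rfl fun i hi => by simp [t', hi]
  calc ∫⁻ ω, g ω ∂P = ∫⁻ ω, g ω ∂((D.prod P).map e) := by rw [hmap]
    _ = ∫⁻ y, g (e y) ∂(D.prod P) := lintegral_map_equiv _ e
    _ ≤ _ := lintegral_prod_le _

namespace OracleProg

variable {X I α β : Type} {Z : Type*}

lemma run_bind (O : X → Z → I) (ω : ℕ → Z) (p : OracleProg X I α) (k : α → OracleProg X I β)
    (n : ℕ) : (p.bind k).run O ω n = (k (p.run O ω n).1).run O ω (p.run O ω n).2 := by
  induction p generalizing n with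
  | ret a => rfl
  | query x c ih => exact ih _ _

/-- After the first query the rest of a program acts as a fresh run on the shifted sequence. Only
outputs are compared, as the call counters differ. -/
lemma run_succ (O : X → Z → I) (ω : ℕ → Z) (p : OracleProg X I α) (n : ℕ) :
    (p.run O ω (n + 1)).1 = (p.run O (fun i => ω (i + 1)) n).1 := by
  induction p generalizing n with
  | ret a => rfl
  | query x c ih => exact ih _ _

section expect

variable [MeasurableSpace Z] (D : Measure Z) (O : X → Z → I)

/-- The expectation of `φ` at the output of a program, computed query by query. -/
def expect (φ : α → ENNReal) : OracleProg X I α → ENNReal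
  | .ret a => φ a
  | .query x c => ∫⁻ z, (c (O x z)).expect φ ∂D

lemma expect_bind (p : OracleProg X I α) (k : α → OracleProg X I β) (φ : β → ENNReal) :
    (p.bind k).expect D O φ = p.expect D O fun a => (k a).expect D O φ := by
  induction p with
  | ret a => rfl
  | query x c ih => exact lintegral_congr fun z => ih _

lemma expect_mono {φ ψ : α → ENNReal} (h : ∀ a, φ a ≤ ψ a) (p : OracleProg X I α) :
    p.expect D O φ ≤ p.expect D O ψ := by
  induction p with
  | ret a => exact h a
  | query x c ih => exact lintegral_mono fun z => ih _

lemma expect_add_const [IsProbabilityMeasure D] (φ : α → ENNReal) (b : ENNReal)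
    (p : OracleProg X I α) : p.expect D O (fun a => φ a + b) = p.expect D O φ + b := by
  induction p with
  | ret a => rfl
  | query x c ih =>
    simp only [expect, ih]
    rw [lintegral_add_right _ measurable_const, lintegral_const, measure_univ, mul_one]

lemma expect_const_mul (φ : α → ENNReal) {b : ENNReal} (hb : b ≠ ⊤)
    (p : OracleProg X I α) : p.expect D O (fun a => b * φ a) = b * p.expect D O φ := by
  induction p with
  | ret a => rfl
  | query x c ih =>
    simp only [expect, ih]
    rw [lintegral_const_mul' _ _ hb]

lemma lintegral_run_le_expect [IsProbabilityMeasure D] (φ : α → ENNReal)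
    (p : OracleProg X I α) :
    ∫⁻ ω, φ (p.run O ω 0).1 ∂(Measure.infinitePi fun _ : ℕ => D) ≤ p.expect D O φ := by
  induction p with
  | ret a => simp [run, expect]
  | query x c ih =>
    refine (lintegral_infinitePi_nat_le D _).trans (lintegral_mono fun z => ?_)
    refine le_trans (lintegral_mono fun ω => ?_) (ih (O x z))
    simp only [run, run_succ]
    exact le_rfl

/-- Affine bounds propagate through expectations. -/
lemma expect_ofReal_affine_le [IsProbabilityMeasure D] {u : α → ℝ} {B : ℝ}
    {p : OracleProg X I α} (hB : 0 ≤ B)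
    (h : p.expect D O (fun y => ENNReal.ofReal (u y)) ≤ ENNReal.ofReal B)
    {a b : ℝ} (ha : 0 ≤ a) (hb : 0 ≤ b) :
    p.expect D O (fun y => ENNReal.ofReal (a * u y + b)) ≤ ENNReal.ofReal (a * B + b) := by
  calc p.expect D O (fun y => ENNReal.ofReal (a * u y + b))
      ≤ p.expect D O (fun y => ENNReal.ofReal a * ENNReal.ofReal (u y) + ENNReal.ofReal b) :=
        expect_mono D O (fun y => by
          rw [← ENNReal.ofReal_mul ha]; exact ENNReal.ofReal_add_le) p
    _ = ENNReal.ofReal a * p.expect D O (fun y => ENNReal.ofReal (u y)) + ENNReal.ofReal b := by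
        rw [expect_add_const, expect_const_mul _ _ _ ENNReal.ofReal_ne_top]
    _ ≤ ENNReal.ofReal a * ENNReal.ofReal B + ENNReal.ofReal b := by gcongr
    _ = _ := by
        rw [← ENNReal.ofReal_mul ha, ← ENNReal.ofReal_add (by positivity) hb]

/-- Jensen's inequality for the square. -/
lemma expect_ofReal_le_of_sq [IsProbabilityMeasure D] {u : α → ℝ} {B : ℝ}
    {p : OracleProg X I α} (hB : 0 ≤ B)
    (h : p.expect D O (fun y => ENNReal.ofReal (u y ^ 2)) ≤ ENNReal.ofReal (B ^ 2)) :
    p.expect D O (fun y => ENNReal.ofReal (u y)) ≤ ENNReal.ofReal B := by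
  -- The tangent bound `u ≤ (u² + b²)/(2b)` reduces Jensen's inequality to an affine bound. Taking
  -- `b > B` covers `B = 0`.
  have key : ∀ b, B < b → p.expect D O (fun y => ENNReal.ofReal (u y)) ≤ ENNReal.ofReal b := by
    intro b hb
    have hb0 : 0 < b := hB.trans_lt hb
    have h1 : p.expect D O (fun y => ENNReal.ofReal (u y ^ 2)) ≤ ENNReal.ofReal (b ^ 2) :=
      h.trans (ENNReal.ofReal_le_ofReal (by nlinarith))
    have h2 := expect_ofReal_affine_le D O (sq_nonneg b) h1
      (by positivity : 0 ≤ 1 / (2 * b)) (by positivity : 0 ≤ b / 2)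
    have h3 : 1 / (2 * b) * b ^ 2 + b / 2 = b := by field_simp; ring
    rw [h3] at h2
    refine le_trans (expect_mono D O (fun y => ENNReal.ofReal_le_ofReal ?_) p) h2
    have h4 : 1 / (2 * b) * u y ^ 2 + b / 2 - u y = (u y - b) ^ 2 / (2 * b) := by
      field_simp; ring
    have : 0 ≤ (u y - b) ^ 2 / (2 * b) := by positivity
    linarith
  refine ENNReal.le_of_forall_pos_le_add fun η hη _ => ?_
  have := key (B + η) (lt_add_of_pos_right _ (by exact_mod_cast hη))
  rwa [ENNReal.ofReal_add hB (NNReal.coe_nonneg η), ENNReal.ofReal_coe_nnreal] at this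

end expect

/-! ### Measurability and number of queries -/

/-- A family of programs that make `q` queries each and whose output depends measurably on the
parameter and the samples. -/
structure IsRegular [MeasurableSpace Z] [MeasurableSpace α] {S : Type} [MeasurableSpace S]
    (O : X → Z → I) (p : S → OracleProg X I α) (q : ℕ) : Prop where
  count : ∀ s ω n, ((p s).run O ω n).2 = n + q
  measurable : ∀ n, Measurable fun x : S × (ℕ → Z) => ((p x.1).run O x.2 n).1

namespace IsRegular

variable [MeasurableSpace Z] [MeasurableSpace α] [MeasurableSpace β] {S S' : Type}
  [MeasurableSpace S] [MeasurableSpace S'] {O : X → Z → I}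

lemma ret {f : S → α} (hf : Measurable f) :
    IsRegular O (fun s => (OracleProg.ret (f s) : OracleProg X I α)) 0 :=
  ⟨fun _ _ _ => rfl, fun _ => hf.comp measurable_fst⟩

lemma comp {p : S → OracleProg X I α} {q : ℕ} (hp : IsRegular O p q) {g : S' → S}
    (hg : Measurable g) : IsRegular O (fun s => p (g s)) q :=
  ⟨fun _ _ _ => hp.count _ _ _,
    fun n => (hp.measurable n).comp ((hg.comp measurable_fst).prodMk measurable_snd)⟩

/-- A constant number of queries is essential: the continuation then reads the samples from a fixed
offset, so measurability composes. -/
lemma bind {p : S → OracleProg X I α} {q q' : ℕ} {k : S → α → OracleProg X I β}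
    (hp : IsRegular O p q) (hk : IsRegular O (fun y : S × α => k y.1 y.2) q') :
    IsRegular O (fun s => (p s).bind (k s)) (q + q') := by
  refine ⟨fun s ω n => ?_, fun n => ?_⟩
  · rw [run_bind, hk.count (s, _), hp.count, add_assoc]
  · simp only [run_bind, hp.count]
    exact (hk.measurable (n + q)).comp
      ((measurable_fst.prodMk (hp.measurable n)).prodMk measurable_snd)

end IsRegular

end OracleProg

/-! ### Stochastic gradients -/

section StochasticGradient

variable {Z : Type*} [MeasurableSpace Z]

/-- Fundamental theorem of calculus and Cauchy–Schwarz. No regularity of `φ'` is needed: if its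
square is not integrable the right side is infinite, and otherwise `φ'` is integrable. -/
lemma sq_sub_le_lintegral_deriv_sq {φ φ' : ℝ → ℝ} (hd : ∀ s, HasDerivAt φ (φ' s) s)
    (hm : Measurable φ') {h : ℝ} (hh : 0 < h) :
    ENNReal.ofReal ((φ h - φ 0) ^ 2)
      ≤ ENNReal.ofReal h * ∫⁻ s in Set.Ioc 0 h, ENNReal.ofReal (φ' s ^ 2) := by
  rcases eq_or_ne (∫⁻ s in Set.Ioc 0 h, ENNReal.ofReal (φ' s ^ 2)) ⊤ with htop | htop
  · rw [htop, ENNReal.mul_top (by simpa using hh)]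
    exact le_top
  set ν := volume.restrict (Set.Ioc 0 h) with hν
  have hmass : ν.real Set.univ = h := by simp [hν, hh.le]
  have hsq : Integrable (fun s => φ' s ^ 2) ν := by
    refine ⟨(hm.pow_const 2).aestronglyMeasurable, ?_⟩
    rw [hasFiniteIntegral_iff_ofReal (Filter.Eventually.of_forall fun s => sq_nonneg _)]
    exact lt_top_iff_ne_top.2 htop
  have hint : Integrable φ' ν :=
    ((memLp_two_iff_integrable_sq hm.aestronglyMeasurable).2 hsq).integrable one_le_two
  have hftc : ∫ s, φ' s ∂ν = φ h - φ 0 := by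
    rw [← intervalIntegral.integral_eq_sub_of_hasDerivAt (fun s _ => hd s)
      ((intervalIntegrable_iff_integrableOn_Ioc_of_le hh.le).2 hint),
      intervalIntegral.integral_of_le hh.le]
  set J := φ h - φ 0 with hJ
  -- Cauchy–Schwarz as nonnegativity of the variance of `φ'` about its mean `J / h`.
  have hcs : J ^ 2 ≤ h * ∫ s, φ' s ^ 2 ∂ν := by
    have h1 : 0 ≤ ∫ s, (φ' s - J / h) ^ 2 ∂ν := integral_nonneg fun s => sq_nonneg _
    have h2 : ∫ s, (φ' s - J / h) ^ 2 ∂ν = ∫ s, φ' s ^ 2 ∂ν - J ^ 2 / h := by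
      have h3 : ∀ s, (φ' s - J / h) ^ 2 = φ' s ^ 2 - 2 * (J / h) * φ' s + (J / h) ^ 2 :=
        fun s => by ring
      simp only [h3]
      have h4 : Integrable (fun s => φ' s ^ 2 - 2 * (J / h) * φ' s) ν :=
        hsq.sub (hint.const_mul _)
      rw [integral_add h4 (integrable_const _), integral_sub hsq (hint.const_mul _), integral_const_mul, hftc, integral_const, hmass,
        smul_eq_mul]
      field_simp
      ring
    rw [h2] at h1
    have h4 : J ^ 2 / h ≤ ∫ s, φ' s ^ 2 ∂ν := by linarith
    rw [div_le_iff₀ hh] at h4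
    linarith
  rw [← ofReal_integral_eq_lintegral_ofReal hsq (Filter.Eventually.of_forall fun s => sq_nonneg _),
    ← ENNReal.ofReal_mul hh.le]
  exact ENNReal.ofReal_le_ofReal hcs

/-- The derivative is a pointwise limit of difference quotients, and `g` is jointly measurable
because it is continuous in one variable and measurable in the other. -/
lemma measurable_deriv_param {g g' : ℝ → Z → ℝ}
    (hd : ∀ z s, HasDerivAt (fun s => g s z) (g' s z) s) (hm : ∀ s, Measurable (g s)) :
    Measurable (Function.uncurry g') := by
  have hg : Measurable (Function.uncurry g) := by
    have := measurable_uncurry_of_continuous_of_measurable (u := g)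
      (fun z => continuous_iff_continuousAt.2 fun s => (hd z s).continuousAt) hm
    exact this
  refine measurable_of_tendsto_metrizable (f := fun (k : ℕ) (y : ℝ × Z) =>
    (1 / ((k : ℝ) + 1))⁻¹ • (g (y.1 + 1 / ((k : ℝ) + 1)) y.2 - g y.1 y.2)) (fun k => ?_) ?_
  · have h1 : Measurable fun y : ℝ × Z => g (y.1 + 1 / ((k : ℝ) + 1)) y.2 - g y.1 y.2 :=
      (hg.comp ((measurable_fst.add_const _).prodMk measurable_snd)).sub hg
    exact Measurable.const_smul h1 (1 / ((k : ℝ) + 1))⁻¹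
  · rw [tendsto_pi_nhds]
    intro y
    have h1 := (hasDerivAt_iff_tendsto_slope_zero.1 (hd y.2 y.1))
    refine h1.comp (tendsto_nhdsWithin_iff.2 ⟨tendsto_one_div_add_atTop_nhds_zero_nat, ?_⟩)
    exact Filter.Eventually.of_forall fun k => (by positivity : (1 : ℝ) / ((k : ℝ) + 1) ≠ 0)

lemma integrable_of_lintegral_sq_le {D : Measure Z} [IsProbabilityMeasure D] {X : Z → ℝ}
    (hX : Measurable X) {K : ℝ} (hK : ∫⁻ z, ENNReal.ofReal (X z ^ 2) ∂D ≤ ENNReal.ofReal K)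
    (hK0 : 0 ≤ K) :
    Integrable X D ∧ Integrable (fun z => X z ^ 2) D ∧ ∫ z, X z ^ 2 ∂D ≤ K := by
  have hsq : Integrable (fun s => X s ^ 2) D := by
    refine ⟨(hX.pow_const 2).aestronglyMeasurable, ?_⟩
    rw [hasFiniteIntegral_iff_ofReal (Filter.Eventually.of_forall fun s => sq_nonneg _)]
    exact hK.trans_lt ENNReal.ofReal_lt_top
  refine ⟨((memLp_two_iff_integrable_sq hX.aestronglyMeasurable).2 hsq).integrable one_le_two,
    hsq, ?_⟩
  rw [← ofReal_integral_eq_lintegral_ofReal hsq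
    (Filter.Eventually.of_forall fun s => sq_nonneg _)] at hK
  exact (ENNReal.ofReal_le_ofReal_iff hK0).1 hK

lemma abs_sub_clamp_le (x : ℝ) {M : ℝ} (hM : 0 < M) :
    |x - max (-M) (min x M)| ≤ x ^ 2 / M := by
  rw [le_div_iff₀ hM]
  rcases le_total x M with h1 | h1
  · rw [min_eq_left h1]
    rcases le_total (-M) x with h2 | h2
    · rw [max_eq_right h2]; simp; positivity
    · rw [max_eq_left h2, abs_of_nonpos (by linarith)]; nlinarith
  · rw [min_eq_right h1, max_eq_right (by linarith), abs_of_nonneg (by linarith)]; nlinarith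

/-- Means converge along a pointwise convergent sequence that is bounded in `L²`. -/
lemma integral_eq_zero_of_tendsto {D : Measure Z} [IsProbabilityMeasure D] {X : ℕ → Z → ℝ}
    {Y : Z → ℝ} (hX : ∀ k, Measurable (X k)) (hY : Measurable Y) {K : ℝ} (hK0 : 0 ≤ K)
    (hXK : ∀ k, ∫⁻ z, ENNReal.ofReal (X k z ^ 2) ∂D ≤ ENNReal.ofReal K)
    (hYK : ∫⁻ z, ENNReal.ofReal (Y z ^ 2) ∂D ≤ ENNReal.ofReal K)
    (hlim : ∀ z, Filter.Tendsto (fun k => X k z) Filter.atTop (nhds (Y z)))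
    (h0 : ∀ k, ∫ z, X k z ∂D = 0) : ∫ z, Y z ∂D = 0 := by
  -- Truncation at level `M` changes each mean by at most `K / M`, uniformly in `k`. Truncated means
  -- converge by dominated convergence, so the limit mean is at most `2K / M` in absolute value, for
  -- every `M`.
  let τ : ℝ → ℝ → ℝ := fun M x => max (-M) (min x M)
  have hτc : ∀ M, Continuous (τ M) := fun M => by fun_prop
  have hτb : ∀ M, 0 < M → ∀ x, ‖τ M x‖ ≤ M := fun M hM x => by
    rw [Real.norm_eq_abs, abs_le]
    exact ⟨le_max_left _ _, max_le (by linarith) (min_le_right _ _)⟩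
  have hτi : ∀ M, 0 < M → ∀ W : Z → ℝ, Measurable W → Integrable (fun z => τ M (W z)) D :=
    fun M hM W hW => Integrable.of_bound ((hτc M).measurable.comp hW).aestronglyMeasurable M
      (Filter.Eventually.of_forall fun z => hτb M hM _)
  have hdiff : ∀ M, 0 < M → ∀ W : Z → ℝ, Measurable W →
      (∫⁻ z, ENNReal.ofReal (W z ^ 2) ∂D ≤ ENNReal.ofReal K) →
      |∫ z, W z ∂D - ∫ z, τ M (W z) ∂D| ≤ K / M := by
    intro M hM W hW hWK
    obtain ⟨h1, h2, h3⟩ := integrable_of_lintegral_sq_le hW hWK hK0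
    rw [← integral_sub h1 (hτi M hM W hW)]
    calc |∫ z, (W z - τ M (W z)) ∂D| ≤ ∫ z, |W z - τ M (W z)| ∂D := abs_integral_le_integral_abs
      _ ≤ ∫ z, W z ^ 2 / M ∂D :=
        integral_mono (h1.sub (hτi M hM W hW)).abs (h2.div_const M)
          fun z => abs_sub_clamp_le (W z) hM
      _ = (∫ z, W z ^ 2 ∂D) / M := integral_div _ _
      _ ≤ K / M := by gcongr
  have hbound : ∀ M, 0 < M → |∫ z, Y z ∂D| ≤ 2 * K / M := by
    intro M hM
    have h1 : Filter.Tendsto (fun k => ∫ z, τ M (X k z) ∂D) Filter.atTop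
        (nhds (∫ z, τ M (Y z) ∂D)) :=
      tendsto_integral_of_dominated_convergence (fun _ => M)
        (fun k => ((hτc M).measurable.comp (hX k)).aestronglyMeasurable) (integrable_const M)
        (fun k => Filter.Eventually.of_forall fun z => hτb M hM _)
        (Filter.Eventually.of_forall fun z => ((hτc M).tendsto _).comp (hlim z))
    have h2 : |∫ z, τ M (Y z) ∂D| ≤ K / M := by
      refine le_of_tendsto h1.abs (Filter.Eventually.of_forall fun k => ?_)
      have := hdiff M hM (X k) (hX k) (hXK k)
      rwa [h0 k, zero_sub, abs_neg] at this
    have h3 := hdiff M hM Y hY hYK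
    have h4 := abs_sub_abs_le_abs_sub (∫ z, Y z ∂D) (∫ z, τ M (Y z) ∂D)
    have h5 : 2 * K / M = K / M + K / M := by ring
    linarith
  by_contra hne
  have hpos : 0 < |∫ z, Y z ∂D| := abs_pos.2 hne
  have h1 := hbound ((2 * K + 1) / |∫ z, Y z ∂D|) (by positivity)
  rw [div_div_eq_mul_div, le_div_iff₀ (by positivity)] at h1
  nlinarith

/-- Differentiation under the expectation for centered families with derivatives bounded
in `L²`. -/
lemma integral_deriv_eq_zero {D : Measure Z} [IsProbabilityMeasure D] {g g' : ℝ → Z → ℝ}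
    (hd : ∀ z s, HasDerivAt (fun s => g s z) (g' s z) s) (hm : ∀ s, Measurable (g s))
    (hi : ∀ s, Integrable (g s) D) (h0 : ∀ s, ∫ z, g s z ∂D = 0) {K : ℝ} (hK0 : 0 ≤ K)
    (hK : ∀ s, ∫⁻ z, ENNReal.ofReal (g' s z ^ 2) ∂D ≤ ENNReal.ofReal K) :
    ∫ z, g' 0 z ∂D = 0 := by
  have hjoint := measurable_deriv_param hd hm
  have hη : ∀ k : ℕ, (0 : ℝ) < 1 / ((k : ℝ) + 1) := fun k => by positivity
  refine integral_eq_zero_of_tendsto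
    (X := fun k z => (1 / ((k : ℝ) + 1))⁻¹ * (g (1 / ((k : ℝ) + 1)) z - g 0 z))
    (fun k => ((hm _).sub (hm _)).const_mul _) (hjoint.comp measurable_prodMk_left) hK0
    (fun k => ?_) (hK 0) (fun z => ?_) (fun k => ?_)
  · set h := 1 / ((k : ℝ) + 1) with hh
    have hh0 : 0 < h := hη k
    -- The difference quotients inherit the `L²` bound of the derivative: after Tonelli the factors
    -- `h⁻²`, `h` and the length `h` of the interval cancel.
    calc ∫⁻ z, ENNReal.ofReal ((h⁻¹ * (g h z - g 0 z)) ^ 2) ∂D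
        ≤ ∫⁻ z, ENNReal.ofReal (h⁻¹ ^ 2) * (ENNReal.ofReal h
            * ∫⁻ s in Set.Ioc 0 h, ENNReal.ofReal (g' s z ^ 2)) ∂D := by
          refine lintegral_mono fun z => ?_
          dsimp only
          rw [mul_pow, ENNReal.ofReal_mul (by positivity)]
          gcongr
          exact sq_sub_le_lintegral_deriv_sq (hd z) (hjoint.comp measurable_prodMk_right) hh0
      _ = ENNReal.ofReal (h⁻¹ ^ 2) * (ENNReal.ofReal h
            * ∫⁻ s in Set.Ioc 0 h, ∫⁻ z, ENNReal.ofReal (g' s z ^ 2) ∂D) := by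
          rw [lintegral_const_mul' _ _ ENNReal.ofReal_ne_top,
            lintegral_const_mul' _ _ ENNReal.ofReal_ne_top, lintegral_lintegral_swap]
          exact (((hjoint.comp measurable_swap).pow_const 2).ennreal_ofReal).aemeasurable
      _ ≤ ENNReal.ofReal (h⁻¹ ^ 2) * (ENNReal.ofReal h
            * ∫⁻ s in Set.Ioc 0 h, ENNReal.ofReal K) := by
          gcongr with s
          exact hK s
      _ = ENNReal.ofReal K := by
          rw [lintegral_const, Measure.restrict_apply_univ, Real.volume_Ioc, sub_zero,
            ← ENNReal.ofReal_mul hK0, ← ENNReal.ofReal_mul hh0.le,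
            ← ENNReal.ofReal_mul (by positivity)]
          congr 1
          field_simp
  · have h1 := (hasDerivAt_iff_tendsto_slope_zero.1 (hd z 0))
    have h2 := h1.comp (tendsto_nhdsWithin_iff.2
      ⟨tendsto_one_div_add_atTop_nhds_zero_nat (𝕜 := ℝ), Filter.Eventually.of_forall fun k =>
        (by positivity : (1 : ℝ) / ((k : ℝ) + 1) ≠ 0)⟩)
    simpa only [Function.comp_def, zero_add, smul_eq_mul] using h2
  · rw [integral_const_mul, integral_sub (hi _) (hi _), h0, h0, sub_zero, mul_zero]

variable {d : ℕ}

lemma measurable_euc_of_inner {S : Type*} [MeasurableSpace S] {u : S → Euc d}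
    (h : ∀ b : Euc d, Measurable fun s => (inner ℝ (u s) b : ℝ)) : Measurable u := by
  have h1 : u = fun s => ∑ i, (inner ℝ (u s) (EuclideanSpace.basisFun (Fin d) ℝ i) : ℝ)
      • EuclideanSpace.basisFun (Fin d) ℝ i := by
    funext s
    conv_lhs => rw [← (EuclideanSpace.basisFun (Fin d) ℝ).sum_repr' (u s)]
    exact Finset.sum_congr rfl fun i _ => by rw [real_inner_comm]
  rw [h1]
  exact Finset.measurable_sum _ fun i _ => (h _).smul_const _

lemma hasDerivAt_line {F : Euc d → ℝ} (hF : Differentiable ℝ F) (x b : Euc d) (s : ℝ) :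
    HasDerivAt (fun s : ℝ => F (x + s • b)) (inner ℝ (gradient F (x + s • b)) b) s := by
  have h1 : HasDerivAt (fun s : ℝ => x + s • b) b s := by
    simpa using ((hasDerivAt_id s).smul_const b).const_add x
  have h2 := (hF (x + s • b)).hasGradientAt.hasFDerivAt.comp_hasDerivAt s h1
  simpa [Function.comp_def] using h2

namespace IsStochasticOracle

variable {F : Euc d → ℝ} {σ : ℝ} {f : Euc d → Z → ℝ} {D : Measure Z}

lemma measurable_uncurry (h : IsStochasticOracle F σ f D) :
    Measurable fun y : Euc d × Z => f y.1 y.2 :=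
  measurable_uncurry_of_continuous_of_measurable (u := f)
    (fun z => (h.differentiable z).continuous) h.measurable

lemma measurable_gradient (h : IsStochasticOracle F σ f D) :
    Measurable fun y : Euc d × Z => gradient (fun x => f x y.2) y.1 := by
  refine measurable_euc_of_inner fun b => ?_
  refine measurable_of_tendsto_metrizable (f := fun (k : ℕ) (y : Euc d × Z) =>
    (1 / ((k : ℝ) + 1))⁻¹ • (f (y.1 + (0 + 1 / ((k : ℝ) + 1)) • b) y.2
      - f (y.1 + (0 : ℝ) • b) y.2)) (fun k => ?_) ?_
  · have h1 : ∀ c : ℝ, Measurable fun y : Euc d × Z => f (y.1 + c • b) y.2 := fun c =>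
      h.measurable_uncurry.comp ((measurable_fst.add_const _).prodMk measurable_snd)
    exact Measurable.const_smul ((h1 (0 + 1 / ((k : ℝ) + 1))).sub (h1 0)) (1 / ((k : ℝ) + 1))⁻¹
  · rw [tendsto_pi_nhds]
    intro y
    have h1 := hasDerivAt_iff_tendsto_slope_zero.1 (hasDerivAt_line (h.differentiable y.2) y.1 b 0)
    rw [zero_smul, add_zero] at h1
    refine Filter.Tendsto.comp (g := fun t : ℝ => t⁻¹ • (f (y.1 + (0 + t) • b) y.2
      - f (y.1 + (0 : ℝ) • b) y.2)) (by simpa using h1)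
      (tendsto_nhdsWithin_iff.2 ⟨tendsto_one_div_add_atTop_nhds_zero_nat, ?_⟩)
    exact Filter.Eventually.of_forall fun k => (by positivity : (1 : ℝ) / ((k : ℝ) + 1) ≠ 0)

variable [IsProbabilityMeasure D]

/-- Stochastic gradients are unbiased. -/
lemma integral_inner_noise (h : IsStochasticOracle F σ f D) (hF : Differentiable ℝ F)
    (x b : Euc d) :
    ∫ z, (inner ℝ b (gradient (fun y => f y z) x - gradient F x) : ℝ) ∂D = 0 := by
  -- The centered values `f - F` are differentiated along the line through `x` in direction `b`; the
  -- variance bound controls the derivative in `L²`.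
  have key := integral_deriv_eq_zero (D := D)
    (g := fun s z => f (x + s • b) z - F (x + s • b))
    (g' := fun s z => inner ℝ (gradient (fun y => f y z) (x + s • b)) b
      - inner ℝ (gradient F (x + s • b)) b)
    (fun z s => (hasDerivAt_line (h.differentiable z) x b s).sub (hasDerivAt_line hF x b s))
    (fun s => (h.measurable _).sub_const _)
    (fun s => (h.integrable _).sub (integrable_const _))
    (fun s => by
      rw [integral_sub (h.integrable _) (integrable_const _), ← h.mean]; simp)
    (K := ‖b‖ ^ 2 * σ ^ 2) (by positivity) (fun s => ?_)
  · rw [← key]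
    refine integral_congr_ae (Filter.Eventually.of_forall fun z => ?_)
    simp only [zero_smul, add_zero]
    rw [← inner_sub_left, real_inner_comm]
  · calc ∫⁻ z, ENNReal.ofReal ((inner ℝ (gradient (fun y => f y z) (x + s • b)) b
          - inner ℝ (gradient F (x + s • b)) b) ^ 2) ∂D
        ≤ ∫⁻ z, ENNReal.ofReal (‖b‖ ^ 2) * ENNReal.ofReal
            (‖gradient (fun y => f y z) (x + s • b) - gradient F (x + s • b)‖ ^ 2) ∂D := by
          refine lintegral_mono fun z => ?_
          dsimp only
          rw [← ENNReal.ofReal_mul (by positivity), ← inner_sub_left, ← mul_pow, mul_comm ‖b‖]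
          refine ENNReal.ofReal_le_ofReal (sq_le_sq' ?_ (real_inner_le_norm _ _))
          exact neg_le_of_abs_le (abs_real_inner_le_norm _ _)
      _ ≤ _ := by
          rw [lintegral_const_mul' _ _ ENNReal.ofReal_ne_top, ENNReal.ofReal_mul (by positivity)]
          gcongr
          exact h.variance _

end IsStochasticOracle

/-! ### Access to an objective -/

/-- Expectations of nonnegative quadratic functions of the noise are bounded as for unbiased
gradients with variance at most `σ ^ 2`. -/
def NoisyGradient (D : Measure Z) (f : Euc d → Z → ℝ) (σ : ℝ) (Ψ : Euc d → ℝ)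
    (A : Euc d → FOProg d (ℝ × Euc d)) : Prop :=
  ∀ (x : Euc d) (a : ℝ) (b : Euc d) (e : ℝ), 0 ≤ e →
    (∀ v : Euc d, 0 ≤ a + inner ℝ b v + e * ‖v‖ ^ 2) →
    (A x).expect D (oracleAnswer f) (fun p => ENNReal.ofReal
      (a + inner ℝ b (p.2 - gradient Ψ x) + e * ‖p.2 - gradient Ψ x‖ ^ 2))
      ≤ ENNReal.ofReal (a + e * σ ^ 2)

/-- Nonnegativity of the whole quadratic turns the lower integral into a Bochner integral, where the
linear term vanishes by unbiasedness. The signed linear term could not be integrated alone in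
`ENNReal`. -/
lemma noisyGradient_askOracle {F : Euc d → ℝ} {σ : ℝ} {f : Euc d → Z → ℝ} {D : Measure Z}
    [IsProbabilityMeasure D] (h : IsStochasticOracle F σ f D) (hF : Differentiable ℝ F) :
    NoisyGradient D f σ F askOracle := by
  intro x a b e he hnn
  simp only [askOracle, OracleProg.expect, oracleAnswer]
  set ξ : Z → Euc d := fun z => gradient (fun y => f y z) x - gradient F x with hξ
  have hξm : Measurable ξ := (h.measurable_gradient.comp measurable_prodMk_left).sub_const _
  obtain ⟨h1, h2, h3⟩ := integrable_of_lintegral_sq_le hξm.norm (h.variance x) (sq_nonneg σ)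
  have h4 : Integrable (fun z => (inner ℝ b (ξ z) : ℝ)) D := by
    refine (h1.const_mul ‖b‖).mono' ((hξm.const_inner).aestronglyMeasurable)
      (Filter.Eventually.of_forall fun z => norm_inner_le_norm _ _)
  have h6 : Integrable (fun z => a + inner ℝ b (ξ z)) D := (integrable_const a).add h4
  have h5 : Integrable (fun z => a + inner ℝ b (ξ z) + e * ‖ξ z‖ ^ 2) D :=
    h6.add (h2.const_mul e)
  change ∫⁻ z, ENNReal.ofReal (a + inner ℝ b (ξ z) + e * ‖ξ z‖ ^ 2) ∂D ≤ _
  rw [← ofReal_integral_eq_lintegral_ofReal h5 (Filter.Eventually.of_forall fun z => hnn _)]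
  refine ENNReal.ofReal_le_ofReal ?_
  rw [integral_add h6 (h2.const_mul e),
    integral_add (integrable_const a) h4, h.integral_inner_noise hF, integral_const_mul]
  simp only [integral_const, probReal_univ, one_smul, add_zero]
  gcongr

lemma NoisyGradient.addKnown {D : Measure Z} {f : Euc d → Z → ℝ} {σ : ℝ} {Ψ r : Euc d → ℝ}
    {A : Euc d → FOProg d (ℝ × Euc d)} (h : NoisyGradient D f σ Ψ A)
    (hΨ : Differentiable ℝ Ψ) (hr : Differentiable ℝ r) :
    NoisyGradient D f σ (fun x => Ψ x + r x) (addKnown r A) := by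
  intro x a b e he hnn
  have h1 : gradient (fun x => Ψ x + r x) x = gradient Ψ x + gradient r x :=
    ((hΨ x).hasGradientAt.add_fun (hr x).hasGradientAt).gradient
  have := h x a b e he hnn
  simp only [_root_.addKnown, OracleProg.expect_bind, OracleProg.expect, h1, add_sub_add_right_eq_sub]
  exact this

lemma isRegular_askOracle {F : Euc d → ℝ} {σ : ℝ} {f : Euc d → Z → ℝ} {D : Measure Z}
    (h : IsStochasticOracle F σ f D) :
    OracleProg.IsRegular (oracleAnswer f) (askOracle (d := d)) 1 := by
  refine ⟨fun _ _ _ => rfl, fun n => ?_⟩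
  have h1 : Measurable fun x : Euc d × (ℕ → Z) => (x.1, x.2 n) :=
    measurable_fst.prodMk ((measurable_pi_apply n).comp measurable_snd)
  exact (h.measurable_uncurry.comp h1).prodMk (h.measurable_gradient.comp h1)

lemma isRegular_addKnown {S : Type} [MeasurableSpace S] {f : Euc d → Z → ℝ}
    {A : S → Euc d → FOProg d (ℝ × Euc d)} {q : ℕ} {r : S → Euc d → ℝ}
    (hA : OracleProg.IsRegular (oracleAnswer f) (fun y : S × Euc d => A y.1 y.2) q)
    (hr : Measurable fun y : S × Euc d => r y.1 y.2)
    (hr' : Measurable fun y : S × Euc d => gradient (r y.1) y.2) :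
    OracleProg.IsRegular (oracleAnswer f) (fun y : S × Euc d => addKnown (r y.1) (A y.1) y.2) q := by
  refine hA.bind (q' := 0) (OracleProg.IsRegular.ret ?_)
  refine Measurable.prodMk ?_ ?_
  · exact (measurable_fst.comp measurable_snd).add (hr.comp measurable_fst)
  · exact (measurable_snd.comp measurable_snd).add (hr'.comp measurable_fst)

end StochasticGradient

/-! ### AC-SA -/

section ACSA

variable {d : ℕ}

lemma norm_combo_sq_le {p q : ℝ} (hp : 0 ≤ p) (hq : 0 ≤ q) (hpq : p + q = 1) (u v : Euc d) :
    ‖p • u + q • v‖ ^ 2 ≤ p * ‖u‖ ^ 2 + q * ‖v‖ ^ 2 := by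
  have h1 : p * ‖u‖ ^ 2 + q * ‖v‖ ^ 2 - ‖p • u + q • v‖ ^ 2 = p * q * ‖u - v‖ ^ 2 := by
    rw [norm_add_sq_real, norm_sub_sq_real, norm_smul, norm_smul, inner_smul_left,
      inner_smul_right, mul_pow, mul_pow, Real.norm_eq_abs, Real.norm_eq_abs, sq_abs, sq_abs]
    have : q = 1 - p := by linarith
    subst this
    simp
    ring
  have : 0 ≤ p * q * ‖u - v‖ ^ 2 := by positivity
  linarith

/-- One step of AC-SA with gradient noise `v` decreases the potential up to terms in `v`. -/
lemma acsa_potential_le {L μ : ℝ} {Ψ : Euc d → ℝ} (h : SmoothStronglyConvex L μ Ψ) {xs : Euc d}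
    (hμ : 0 < μ) {α γ : ℝ} (hα0 : 0 < α) (hα1 : α ≤ 1) (hγ : 0 < γ)
    (hLα : L * α ^ 2 ≤ μ + γ) {y ag md w y' ag' : Euc d} (v : Euc d)
    (hmd : md = ((1 - α) * (μ + γ) / (γ + (1 - α ^ 2) * μ)) • ag
      + (α * ((1 - α) * μ + γ) / (γ + (1 - α ^ 2) * μ)) • y)
    (hw : w = (α * μ / (μ + γ)) • md + (((1 - α) * μ + γ) / (μ + γ)) • y)
    (hy' : y' = w - (α / (μ + γ)) • (gradient Ψ md + v))
    (hag' : ag' = α • y' + (1 - α) • ag) :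
    Ψ ag' - Ψ xs + (μ + γ) / 2 * ‖y' - xs‖ ^ 2
      ≤ (1 - α) * (Ψ ag - Ψ xs) + ((1 - α) * μ + γ) / 2 * ‖y - xs‖ ^ 2
        + inner ℝ ((L * (α ^ 2 / (μ + γ)) ^ 2) • gradient Ψ md + α • (xs - w)) v
        + α ^ 2 / (μ + γ) * ‖v‖ ^ 2 := by
  have hP : 0 < μ + γ := by linarith
  have hS : 0 < γ + (1 - α ^ 2) * μ := by
    have : α ^ 2 ≤ 1 := by nlinarith
    exact add_pos_of_pos_of_nonneg hγ (mul_nonneg (by linarith) hμ.le)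
  have hβ : 0 ≤ (1 - α) * μ + γ := by nlinarith
  -- The weights defining `md` are chosen for this identity. Since `w` is the iterate before its
  -- gradient step, it makes `ag' - md` an exact gradient step of length `η`.
  have hcombo : (1 - α) • ag + α • w = md := by
    rw [hw, smul_add, smul_smul, smul_smul]
    have h1 : (1 - α) • ag + (α * (((1 - α) * μ + γ) / (μ + γ))) • y
        = ((γ + (1 - α ^ 2) * μ) / (μ + γ)) • md := by
      rw [hmd]
      generalize γ + (1 - α ^ 2) * μ = q at hS
      match_scalars <;> field_simp
    calc (1 - α) • ag + ((α * (α * μ / (μ + γ))) • md + (α * (((1 - α) * μ + γ) / (μ + γ))) • y)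
        = ((1 - α) • ag + (α * (((1 - α) * μ + γ) / (μ + γ))) • y)
          + (α * (α * μ / (μ + γ))) • md := by abel
      _ = md := by
        rw [h1, ← add_smul]
        have : (γ + (1 - α ^ 2) * μ) / (μ + γ) + α * (α * μ / (μ + γ)) = 1 := by
          field_simp; ring
        rw [this, one_smul]
  set P := μ + γ with hPdef
  set G := gradient Ψ md with hG
  set η := α ^ 2 / P with hη
  have hη0 : 0 ≤ η := by positivity
  have hLη : L * η ≤ 1 := by
    rw [hη, ← mul_div_assoc, div_le_one hP]; exact hLα
  have hag : ag' - md = -(η • (G + v)) := by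
    rw [hag', hy', ← hcombo, smul_sub, smul_smul]
    have : α * (α / P) = η := by rw [hη]; ring
    rw [this]; abel
  have hsm := h.smooth md ag'
  rw [hag, norm_neg, inner_neg_right, inner_smul_right, norm_smul, mul_pow, Real.norm_eq_abs,
    sq_abs, ← hG] at hsm
  have hdist : P / 2 * ‖y' - xs‖ ^ 2
      = P / 2 * ‖w - xs‖ ^ 2 + α * inner ℝ (G + v) (xs - w) + η / 2 * ‖G + v‖ ^ 2 := by
    have h1 : y' - xs = (w - xs) - (α / P) • (G + v) := by rw [hy']; abel
    have h2 : xs - w = -(w - xs) := by abel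
    rw [h1, h2, norm_sub_sq_real, inner_smul_right, norm_smul, mul_pow, Real.norm_eq_abs, sq_abs,
      inner_neg_right, real_inner_comm, hη]
    field_simp
    ring
  have hconv : P / 2 * ‖w - xs‖ ^ 2
      ≤ α * μ / 2 * ‖md - xs‖ ^ 2 + ((1 - α) * μ + γ) / 2 * ‖y - xs‖ ^ 2 := by
    have hsum : α * μ / P + ((1 - α) * μ + γ) / P = 1 := by rw [hPdef]; field_simp; ring
    have h1 : w - xs = (α * μ / P) • (md - xs) + (((1 - α) * μ + γ) / P) • (y - xs) := by
      have h2 : xs = (α * μ / P + ((1 - α) * μ + γ) / P) • xs := by rw [hsum, one_smul]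
      rw [hw]
      conv_lhs => rw [h2]
      rw [add_smul, smul_sub, smul_sub]; abel
    have h3 := norm_combo_sq_le (by positivity) (by positivity) hsum (md - xs) (y - xs)
    rw [← h1] at h3
    have h4 := mul_le_mul_of_nonneg_left h3 (by positivity : 0 ≤ P / 2)
    refine h4.trans_eq ?_
    field_simp
  have hsc1 := mul_le_mul_of_nonneg_left (h.strongly_convex md xs) hα0.le
  have hsc2 := mul_le_mul_of_nonneg_left (h.strongly_convex md ag) (sub_nonneg.2 hα1)
  have hpos : 0 ≤ (1 - α) * (μ / 2 * ‖ag - md‖ ^ 2) := by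
    have := sub_nonneg.2 hα1
    positivity
  rw [← hG, norm_sub_rev xs md] at hsc1
  rw [← hG] at hsc2
  -- The linear terms from strong convexity at `xs` and `ag` combine to the one produced by the
  -- proximal identity `hdist`.
  have hin : α * inner ℝ G (xs - md) + (1 - α) * inner ℝ G (ag - md)
      = α * inner ℝ G (xs - w) := by
    rw [← inner_smul_right, ← inner_smul_right, ← inner_smul_right, ← inner_add_right]
    congr 1
    calc α • (xs - md) + (1 - α) • (ag - md) = α • xs + (1 - α) • ag - md := by module
      _ = α • (xs - w) := by rw [← hcombo]; module
  have e1 : (inner ℝ G (G + v) : ℝ) = ‖G‖ ^ 2 + inner ℝ G v := by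
    rw [inner_add_right, real_inner_self_eq_norm_sq]
  have e2 : ‖G + v‖ ^ 2 = ‖G‖ ^ 2 + 2 * inner ℝ G v + ‖v‖ ^ 2 := norm_add_sq_real _ _
  have e3 : (inner ℝ (G + v) (xs - w) : ℝ) = inner ℝ G (xs - w) + inner ℝ (xs - w) v := by
    rw [inner_add_left, real_inner_comm v]
  rw [e1, e2] at hsm
  rw [e2, e3] at hdist
  rw [inner_add_left, inner_smul_left, inner_smul_left]
  simp only [RCLike.conj_to_real]
  -- The terms in `‖G‖²` add up to `-(1 - Lη) η/2`, which is dropped; those in `‖v‖²` add up to `(1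
  -- + Lη) η/2 ≤ η`.
  have f1 : 0 ≤ (1 - L * η) * (η / 2 * ‖G‖ ^ 2) :=
    mul_nonneg (by linarith) (by positivity)
  have f2 : 0 ≤ (1 - L * η) * (η / 2 * ‖v‖ ^ 2) :=
    mul_nonneg (by linarith) (by positivity)
  linarith

variable {Z : Type*} [MeasurableSpace Z] {D : Measure Z} {f : Euc d → Z → ℝ} {σ : ℝ}
  {Ψ : Euc d → ℝ} {A : Euc d → FOProg d (ℝ × Euc d)} {L μ : ℝ} {xs : Euc d}

/-- The Lyapunov function of AC-SA for the state `(x_t, x_t^{ag})`. -/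
def acsaPotential (L μ : ℝ) (Ψ : Euc d → ℝ) (xs : Euc d) (t : ℕ) (s : Euc d × Euc d) : ℝ :=
  t * (t + 1) * (Ψ s.2 - Ψ xs) + (t * (t + 1) * μ + 4 * L) / 2 * ‖s.1 - xs‖ ^ 2

lemma acsaPotential_nonneg (hL : 0 < L) (hμ : 0 < μ) (hm : ∀ y, Ψ xs ≤ Ψ y) (t : ℕ)
    (s : Euc d × Euc d) : 0 ≤ acsaPotential L μ Ψ xs t s := by
  have := sub_nonneg.2 (hm s.2)
  rw [acsaPotential]
  positivity

lemma expect_acsaStep_le (h : SmoothStronglyConvex L μ Ψ) (hL : 0 < L) (hμ : 0 < μ)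
    (hm : ∀ y, Ψ xs ≤ Ψ y) (hA : NoisyGradient D f σ Ψ A) (t : ℕ) (s : Euc d × Euc d) :
    (acsaStep L μ A (t + 1) s).expect D (oracleAnswer f)
        (fun s' => ENNReal.ofReal (acsaPotential L μ Ψ xs (t + 1) s'))
      ≤ ENNReal.ofReal (acsaPotential L μ Ψ xs t s + 4 * σ ^ 2 / μ) := by
  obtain ⟨y, ag⟩ := s
  simp only [acsaStep, OracleProg.expect_bind, OracleProg.expect]
  set α : ℝ := 2 / (((t + 1 : ℕ) : ℝ) + 1) with hα
  set γ : ℝ := 4 * L / (((t + 1 : ℕ) : ℝ) * (((t + 1 : ℕ) : ℝ) + 1)) with hγ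
  push_cast at hα hγ
  have hα0 : 0 < α := by rw [hα]; positivity
  have hα1 : α ≤ 1 := by
    rw [hα, div_le_one (by positivity)]
    have : (0 : ℝ) ≤ t := by positivity
    linarith
  have hγ0 : 0 < γ := by rw [hγ]; positivity
  have hLα : L * α ^ 2 ≤ μ + γ := by
    have : L * α ^ 2 ≤ γ := by
      rw [hα, hγ, div_pow, ← mul_div_assoc, div_le_div_iff₀ (by positivity) (by positivity)]
      have : (0 : ℝ) ≤ t := by positivity
      nlinarith [mul_nonneg hL.le this, mul_nonneg (mul_nonneg hL.le this) this]
    linarith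
  set md : Euc d := ((1 - α) * (μ + γ) / (γ + (1 - α ^ 2) * μ)) • ag
      + (α * ((1 - α) * μ + γ) / (γ + (1 - α ^ 2) * μ)) • y with hmd
  set w : Euc d := (α * μ / (μ + γ)) • md + (((1 - α) * μ + γ) / (μ + γ)) • y with hw
  -- Multiplied by this weight, the one-step inequality telescopes: `c (1 - α) = t (t + 1)`, `c γ =
  -- 4 L`, and the noise coefficient `c η` stays bounded.
  set c : ℝ := ((t : ℝ) + 1) * (t + 2) with hc
  have hc0 : 0 < c := by positivity
  set b : Euc d := (L * (α ^ 2 / (μ + γ)) ^ 2) • gradient Ψ md + α • (xs - w) with hb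
  set a : ℝ := acsaPotential L μ Ψ xs t (y, ag) with ha
  set η : ℝ := α ^ 2 / (μ + γ) with hη
  have hcα : c * (1 - α) = t * (t + 1) := by rw [hc, hα]; field_simp; ring
  have hcγ : c * γ = 4 * L := by rw [hc, hγ]; field_simp; ring
  have hcη : c * η ≤ 4 / μ := by
    calc c * η ≤ c * (α ^ 2 / μ) := by rw [hη]; gcongr; linarith
      _ = 4 * (((t : ℝ) + 1) / (t + 2)) / μ := by rw [hc, hα]; field_simp; ring
      _ ≤ 4 * 1 / μ := by
        gcongr
        rw [div_le_one (by positivity)]; linarith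
      _ = 4 / μ := by ring
  have hpt : ∀ v : Euc d, acsaPotential L μ Ψ xs (t + 1)
      (w - (α / (μ + γ)) • (gradient Ψ md + v),
        α • (w - (α / (μ + γ)) • (gradient Ψ md + v)) + (1 - α) • ag)
      ≤ a + inner ℝ (c • b) v + (c * η) * ‖v‖ ^ 2 := by
    intro v
    have h1 := acsa_potential_le h (xs := xs) hμ hα0 hα1 hγ0 hLα v hmd hw rfl rfl
    rw [← hb, ← hη] at h1
    have h2 := mul_le_mul_of_nonneg_left h1 hc0.le
    have h3 : ∀ X Y : ℝ, c * (X + (μ + γ) / 2 * Y) = c * X + (c * μ + 4 * L) / 2 * Y := by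
      intro X Y; rw [← hcγ]; ring
    have h4 : ∀ X Y I V : ℝ, c * ((1 - α) * X + ((1 - α) * μ + γ) / 2 * Y + I + η * V)
        = t * (t + 1) * X + (t * (t + 1) * μ + 4 * L) / 2 * Y + c * I + c * η * V := by
      intro X Y I V; rw [← hcγ, ← hcα]; ring
    rw [h3, h4] at h2
    rw [inner_smul_left, ha, acsaPotential, acsaPotential]
    simp only [RCLike.conj_to_real]
    have h5 : (((t + 1 : ℕ) : ℝ)) * (((t + 1 : ℕ) : ℝ) + 1) = c := by rw [hc]; push_cast; ring
    rw [h5]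
    exact h2
  -- The quadratic in the noise dominates a nonnegative potential, which is what `NoisyGradient`
  -- requires.
  have hnn : ∀ v : Euc d, 0 ≤ a + inner ℝ (c • b) v + (c * η) * ‖v‖ ^ 2 := fun v =>
    (acsaPotential_nonneg hL hμ hm _ _).trans (hpt v)
  refine le_trans (OracleProg.expect_mono _ _ (fun p => ENNReal.ofReal_le_ofReal ?_) _)
    ((hA md a (c • b) (c * η) (by positivity) hnn).trans (ENNReal.ofReal_le_ofReal ?_))
  · have := hpt (p.2 - gradient Ψ md)
    rwa [add_sub_cancel] at this
  · have := mul_le_mul_of_nonneg_right hcη (sq_nonneg σ)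
    have h6 : 4 / μ * σ ^ 2 = 4 * σ ^ 2 / μ := by ring
    linarith

lemma expect_acsaIter_le [IsProbabilityMeasure D] (h : SmoothStronglyConvex L μ Ψ) (hL : 0 < L)
    (hμ : 0 < μ) (hm : ∀ y, Ψ xs ≤ Ψ y) (hA : NoisyGradient D f σ Ψ A) (x₀ : Euc d) (n : ℕ) :
    (acsaIter L μ A x₀ n).expect D (oracleAnswer f)
        (fun s => ENNReal.ofReal (acsaPotential L μ Ψ xs n s))
      ≤ ENNReal.ofReal (2 * L * ‖x₀ - xs‖ ^ 2 + n * (4 * σ ^ 2 / μ)) := by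
  induction n with
  | zero =>
    simp only [acsaIter, OracleProg.expect, acsaPotential]
    refine ENNReal.ofReal_le_ofReal (le_of_eq ?_)
    push_cast
    ring
  | succ n ih =>
    simp only [acsaIter, OracleProg.expect_bind]
    refine le_trans (OracleProg.expect_mono _ _ (fun s => expect_acsaStep_le h hL hμ hm hA n s) _)
      ?_
    have h1 := OracleProg.expect_ofReal_affine_le D (oracleAnswer f) (by positivity) ih
      zero_le_one (by positivity : 0 ≤ 4 * σ ^ 2 / μ)
    simp only [one_mul] at h1
    refine h1.trans (ENNReal.ofReal_le_ofReal (le_of_eq ?_))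
    push_cast
    ring

/-- The distance of the output of AC-SA to the minimizer in mean square. -/
lemma expect_acsa_sq_le [IsProbabilityMeasure D] (h : SmoothStronglyConvex L μ Ψ) (hL : 0 < L)
    (hμ : 0 < μ) (hm : ∀ y, Ψ xs ≤ Ψ y) (hA : NoisyGradient D f σ Ψ A) (x₀ : Euc d) {n : ℕ}
    (hn : 0 < n) :
    (acsa L μ A x₀ n).expect D (oracleAnswer f) (fun y => ENNReal.ofReal (‖y - xs‖ ^ 2))
      ≤ ENNReal.ofReal (4 * L / (μ * n ^ 2) * ‖x₀ - xs‖ ^ 2 + 8 * σ ^ 2 / (μ ^ 2 * n)) := by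
  have hn0 : (0 : ℝ) < n := by exact_mod_cast hn
  simp only [acsa, OracleProg.expect_bind, OracleProg.expect]
  have h1 := OracleProg.expect_ofReal_affine_le D (oracleAnswer f) (by positivity)
    (expect_acsaIter_le h hL hμ hm hA x₀ n) (by positivity : 0 ≤ 2 / (μ * n ^ 2)) le_rfl
  refine le_trans (OracleProg.expect_mono _ _ (fun s => ENNReal.ofReal_le_ofReal ?_) _)
    (h1.trans (ENNReal.ofReal_le_ofReal (le_of_eq ?_)))
  · have h2 := h.half_mul_norm_sub_sq_le hm s.2
    have h3 : 0 ≤ Ψ s.2 - Ψ xs := sub_nonneg.2 (hm s.2)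
    have h4 : (n : ℝ) ^ 2 * (Ψ s.2 - Ψ xs) ≤ acsaPotential L μ Ψ xs n s := by
      have h5 : 0 ≤ (n * (n + 1) * μ + 4 * L) / 2 * ‖s.1 - xs‖ ^ 2 := by positivity
      rw [acsaPotential]
      nlinarith
    have h6 : ‖s.2 - xs‖ ^ 2 ≤ 2 / (μ * n ^ 2) * (n ^ 2 * (Ψ s.2 - Ψ xs)) := by
      have : 2 / (μ * (n : ℝ) ^ 2) * (n ^ 2 * (Ψ s.2 - Ψ xs)) = (Ψ s.2 - Ψ xs) * 2 / μ := by
        field_simp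
      rw [this, le_div_iff₀ hμ]
      linarith
    rw [add_zero]
    exact h6.trans (mul_le_mul_of_nonneg_left h4 (by positivity))
  · field_simp
    ring

/-- Two runs of AC-SA contract the distance to the minimizer. -/
lemma expect_acsaSq_le [IsProbabilityMeasure D] (h : SmoothStronglyConvex L μ Ψ) (hL : 0 < L)
    (hμ : 0 < μ) (hm : ∀ y, Ψ xs ≤ Ψ y) (hA : NoisyGradient D f σ Ψ A) (hσ : 0 ≤ σ)
    (x₀ : Euc d) {m n : ℕ} (hmn : m / 2 = n) (hn : 0 < n) {κ : ℝ}
    (hκ : 4 * L / (μ * n ^ 2) ≤ κ) (hκ1 : κ ≤ 1) :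
    (acsaSq L μ A x₀ m).expect D (oracleAnswer f) (fun y => ENNReal.ofReal ‖y - xs‖)
      ≤ ENNReal.ofReal (κ * ‖x₀ - xs‖ + 4 * σ / (μ * Real.sqrt n)) := by
  have hn0 : (0 : ℝ) < n := by exact_mod_cast hn
  have hκ0 : 0 ≤ κ := le_trans (by positivity) hκ
  set s := 8 * σ ^ 2 / (μ ^ 2 * n) with hs
  have hs0 : 0 ≤ s := by positivity
  have hone : ∀ x : Euc d, (acsa L μ A x n).expect D (oracleAnswer f)
      (fun y => ENNReal.ofReal (‖y - xs‖ ^ 2)) ≤ ENNReal.ofReal (κ * ‖x - xs‖ ^ 2 + s) :=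
    fun x => (expect_acsa_sq_le h hL hμ hm hA x hn).trans (ENNReal.ofReal_le_ofReal (by gcongr))
  -- Two runs contract the mean square distance by `κ²`, so the root taken by Jensen's inequality
  -- leaves `κ` itself.
  refine OracleProg.expect_ofReal_le_of_sq D (oracleAnswer f) (by positivity) ?_
  simp only [acsaSq, OracleProg.expect_bind, hmn]
  refine le_trans (OracleProg.expect_mono _ _ hone _) ?_
  refine (OracleProg.expect_ofReal_affine_le D (oracleAnswer f) (by positivity) (hone x₀) hκ0
    hs0).trans (ENNReal.ofReal_le_ofReal ?_)
  have hq : (4 * σ / (μ * Real.sqrt n)) ^ 2 = 2 * s := by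
    rw [div_pow, mul_pow, mul_pow, Real.sq_sqrt hn0.le, hs]
    ring
  have hκs : κ * s ≤ s := by nlinarith
  have hcross : 0 ≤ κ * ‖x₀ - xs‖ * (4 * σ / (μ * Real.sqrt n)) := by positivity
  rw [add_sq, hq]
  nlinarith

variable {S : Type} [MeasurableSpace S] {B : S → Euc d → FOProg d (ℝ × Euc d)}

lemma isRegular_acsaStep
    (hB : OracleProg.IsRegular (oracleAnswer f) (fun y : S × Euc d => B y.1 y.2) 1) (t : ℕ) :
    OracleProg.IsRegular (oracleAnswer f)
      (fun y : S × (Euc d × Euc d) => acsaStep L μ (B y.1) t y.2) 1 := by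
  have hmd : Measurable fun y : S × (Euc d × Euc d) => (y.1,
      ((1 - 2 / ((t : ℝ) + 1)) * (μ + 4 * L / ((t : ℝ) * ((t : ℝ) + 1)))
        / (4 * L / ((t : ℝ) * ((t : ℝ) + 1)) + (1 - (2 / ((t : ℝ) + 1)) ^ 2) * μ)) • y.2.2
      + (2 / ((t : ℝ) + 1) * ((1 - 2 / ((t : ℝ) + 1)) * μ + 4 * L / ((t : ℝ) * ((t : ℝ) + 1)))
        / (4 * L / ((t : ℝ) * ((t : ℝ) + 1)) + (1 - (2 / ((t : ℝ) + 1)) ^ 2) * μ)) • y.2.1) := by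
    fun_prop
  refine (hB.comp hmd).bind (q' := 0) (OracleProg.IsRegular.ret ?_)
  fun_prop

lemma isRegular_acsaIter
    (hB : OracleProg.IsRegular (oracleAnswer f) (fun y : S × Euc d => B y.1 y.2) 1) (n : ℕ) :
    OracleProg.IsRegular (oracleAnswer f)
      (fun y : S × Euc d => acsaIter L μ (B y.1) y.2 n) n := by
  induction n with
  | zero => exact OracleProg.IsRegular.ret (measurable_snd.prodMk measurable_snd)
  | succ n ih =>
    refine ih.bind (q' := 1) ?_
    exact (isRegular_acsaStep hB (n + 1)).comp
      (g := fun y : (S × Euc d) × (Euc d × Euc d) => (y.1.1, y.2)) (by fun_prop)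

lemma isRegular_acsa
    (hB : OracleProg.IsRegular (oracleAnswer f) (fun y : S × Euc d => B y.1 y.2) 1) (n : ℕ) :
    OracleProg.IsRegular (oracleAnswer f) (fun y : S × Euc d => acsa L μ (B y.1) y.2 n) n :=
  (isRegular_acsaIter hB n).bind (q' := 0) (OracleProg.IsRegular.ret (by fun_prop))

lemma isRegular_acsaSq
    (hB : OracleProg.IsRegular (oracleAnswer f) (fun y : S × Euc d => B y.1 y.2) 1) (m : ℕ) :
    OracleProg.IsRegular (oracleAnswer f) (fun y : S × Euc d => acsaSq L μ (B y.1) y.2 m)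
      (m / 2 + m / 2) :=
  (isRegular_acsa hB (m / 2)).bind ((isRegular_acsa hB (m / 2)).comp
    (g := fun y : (S × Euc d) × Euc d => (y.1.1, y.2)) (by fun_prop))

end ACSA

/-! ### Recursive regularization -/

section RecursiveRegularization

variable {d : ℕ}

/-- A minimizer of `G + recReg lam xs t`, where there is one. -/
def regMin (G : Euc d → ℝ) (lam : ℝ) (xs : ℕ → Euc d) (t : ℕ) : Euc d :=
  Classical.epsilon fun z => ∀ y, G z + recReg lam xs t z ≤ G y + recReg lam xs t y

lemma regMin_congr (G : Euc d → ℝ) {lam : ℝ} {xs ys : ℕ → Euc d} {t : ℕ}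
    (h : ∀ k ∈ Icc 1 t, xs k = ys k) : regMin G lam xs t = regMin G lam ys t := by
  rw [regMin, regMin, recReg_congr h]

variable {H lam : ℝ} {G : Euc d → ℝ}

lemma regMin_spec (hG : SmoothStronglyConvex H lam G) (hl : 0 < lam) (xs : ℕ → Euc d) (t : ℕ)
    (y : Euc d) : G (regMin G lam xs t) + recReg lam xs t (regMin G lam xs t)
      ≤ G y + recReg lam xs t y := by
  have h := (hG.add_recReg lam xs t).exists_minimizer (by positivity)
  exact Classical.epsilon_spec h y

/-- The objectives `t` and `t + 1` differ by a multiple of the squared distance to `xs (t + 1)`.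
Adding the two optimality inequalities leaves only that term. -/
lemma norm_regMin_succ_sub_le (hG : SmoothStronglyConvex H lam G) (hl : 0 < lam)
    (xs : ℕ → Euc d) (t : ℕ) :
    ‖regMin G lam xs (t + 1) - xs (t + 1)‖ ≤ ‖regMin G lam xs t - xs (t + 1)‖ := by
  have h1 := regMin_spec hG hl xs (t + 1) (regMin G lam xs t)
  have h2 := regMin_spec hG hl xs t (regMin G lam xs (t + 1))
  rw [recReg_succ, recReg_succ] at h1
  have h3 : lam * 2 ^ t * ‖regMin G lam xs (t + 1) - xs (t + 1)‖ ^ 2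
      ≤ lam * 2 ^ t * ‖regMin G lam xs t - xs (t + 1)‖ ^ 2 := by linarith
  exact le_of_sq_le_sq (le_of_mul_le_mul_left h3 (by positivity)) (norm_nonneg _)

/-- The Lyapunov function of recursive regularization. -/
def metaPotential (G : Euc d → ℝ) (lam : ℝ) (t : ℕ) (xs : ℕ → Euc d) : ℝ :=
  ∑ k ∈ Icc 1 t, 2 ^ k * ‖regMin G lam xs t - xs k‖ + 3 * 2 ^ t * ‖xs t - regMin G lam xs t‖

/-- The minimizer moves by at most `2 ‖y - z‖`. The constant `6` is `2` for this shift in the old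
terms, `1` for the new summand and `3` for the last term. -/
lemma metaPotential_update_le (hG : SmoothStronglyConvex H lam G) (hl : 0 < lam)
    (xs : ℕ → Euc d) (t : ℕ) (y : Euc d) :
    metaPotential G lam (t + 1) (Function.update xs (t + 1) y)
      ≤ ∑ k ∈ Icc 1 t, 2 ^ k * ‖regMin G lam xs t - xs k‖
        + 6 * 2 ^ (t + 1) * ‖y - regMin G lam xs t‖ := by
  set xs' := Function.update xs (t + 1) y with hxs'
  have heq : ∀ k ∈ Icc 1 t, xs' k = xs k := fun k hk =>
    Function.update_of_ne (by have := (Finset.mem_Icc.1 hk).2; omega) _ _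
  have hy : xs' (t + 1) = y := Function.update_self _ _ _
  have h1 := norm_regMin_succ_sub_le hG hl xs' t
  rw [regMin_congr G heq, hy] at h1
  set z := regMin G lam xs t with hz
  set z' := regMin G lam xs' (t + 1) with hz'
  have h2 : ‖z' - z‖ ≤ 2 * ‖y - z‖ := by
    have h3 : z' - z = (z' - y) + (y - z) := by abel
    rw [h3]
    refine (norm_add_le _ _).trans ?_
    rw [norm_sub_rev z y] at h1
    linarith
  have h3 : ∑ k ∈ Icc 1 t, 2 ^ k * ‖z' - xs' k‖
      ≤ ∑ k ∈ Icc 1 t, 2 ^ k * ‖z - xs k‖ + 2 ^ (t + 1) * (2 * ‖y - z‖) := by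
    calc ∑ k ∈ Icc 1 t, 2 ^ k * ‖z' - xs' k‖
        ≤ ∑ k ∈ Icc 1 t, (2 ^ k * ‖z - xs k‖ + 2 ^ k * (2 * ‖y - z‖)) := by
          refine Finset.sum_le_sum fun k hk => ?_
          rw [heq k hk, ← mul_add]
          refine mul_le_mul_of_nonneg_left ?_ (by positivity)
          have h4 : z' - xs k = (z - xs k) + (z' - z) := by abel
          rw [h4]
          exact (norm_add_le _ _).trans (by linarith)
      _ = ∑ k ∈ Icc 1 t, 2 ^ k * ‖z - xs k‖ + (2 ^ (t + 1) - 2) * (2 * ‖y - z‖) := by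
          rw [Finset.sum_add_distrib, ← Finset.sum_mul, sum_Icc_two_pow]
      _ ≤ _ := by
          have : 0 ≤ 2 * ‖y - z‖ := by positivity
          nlinarith
  rw [metaPotential, Finset.sum_Icc_succ_top (by omega), ← hz', hy]
  have h5 : ‖z' - y‖ ≤ ‖y - z‖ := by rwa [norm_sub_rev z y] at h1
  have h6 : ‖y - z'‖ ≤ ‖y - z‖ := by rwa [norm_sub_rev]
  have h7 := mul_le_mul_of_nonneg_left h5 (by positivity : (0 : ℝ) ≤ 2 ^ (t + 1))
  have h8 := mul_le_mul_of_nonneg_left h6 (by positivity : (0 : ℝ) ≤ 3 * 2 ^ (t + 1))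
  linarith

lemma norm_gradient_le_metaPotential (hG : SmoothStronglyConvex H lam G) (hl : 0 < lam)
    (hH : 0 < H) {t : ℕ} (ht : H ≤ 2 ^ (t + 1) * lam) (xs : ℕ → Euc d) :
    ‖gradient G (xs t)‖ ≤ lam * metaPotential G lam t xs := by
  set z := regMin G lam xs t with hz
  have h0 := gradient_eq_zero_of_forall_le (F := fun x => G x + recReg lam xs t x)
    (regMin_spec hG hl xs t)
  -- Stationarity at `z` expresses the gradient of `G` there through the regularizers.
  rw [((hG.hasGradientAt _).add_fun (hasGradientAt_recReg lam xs t _)).gradient, ← hz,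
    add_eq_zero_iff_eq_neg] at h0
  have h1 : ‖gradient G z‖ ≤ lam * ∑ k ∈ Icc 1 t, 2 ^ k * ‖z - xs k‖ := by
    rw [h0, norm_neg, Finset.mul_sum]
    refine (norm_sum_le _ _).trans (Finset.sum_le_sum fun k _ => ?_)
    rw [norm_smul, Real.norm_of_nonneg (by positivity), mul_assoc]
  have h2 := hG.norm_gradient_sub_le hH hl.le (xs t) z
  have h3 := norm_add_le (gradient G (xs t) - gradient G z) (gradient G z)
  rw [sub_add_cancel] at h3
  have h4 := mul_le_mul_of_nonneg_right ht (norm_nonneg (xs t - z))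
  have h5 : 0 ≤ lam * 2 ^ t * ‖xs t - z‖ := by positivity
  rw [metaPotential, ← hz]
  rw [pow_succ] at h4
  linarith

variable {Z : Type*} [MeasurableSpace Z] {D : Measure Z} {f : Euc d → Z → ℝ} {σ : ℝ}
  {A : Euc d → FOProg d (ℝ × Euc d)}

/-- The bound on `n²` makes the contraction factor at most `1/4`, whence `6 * 2^(t+1) / 4 = 3 * 2^t`
reproduces the previous potential. The budget hypothesis is restricted to `0 < t` because with no
rounds the per-round budget is a division by zero. -/
lemma expect_metaIter_le [IsProbabilityMeasure D] (hG : SmoothStronglyConvex H lam G)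
    (hl : 0 < lam) (hH : 0 < H) (hσ : 0 ≤ σ) (hA : NoisyGradient D f σ G A) (x₀ : Euc d)
    {b n : ℕ} (t : ℕ) (hb : 0 < t → b / 2 = n) (hn : 32 * (H / lam) ≤ n ^ 2)
    (ht : 2 ^ t * lam ≤ H) :
    (metaIter acsaSq H lam A x₀ b t).expect D (oracleAnswer f)
        (fun xs => ENNReal.ofReal (metaPotential G lam t xs))
      ≤ ENNReal.ofReal (3 * ‖x₀ - regMin G lam (fun _ => x₀) 0‖
        + t * (48 * σ / (lam * Real.sqrt n))) := by
  induction t with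
  | zero =>
    simp only [metaIter, OracleProg.expect, metaPotential]
    refine ENNReal.ofReal_le_ofReal (le_of_eq ?_)
    simp
  | succ t ih =>
    have hn0 : 0 < n := by
      rcases Nat.eq_zero_or_pos n with h | h
      · rw [h] at hn
        have : 0 < H / lam := by positivity
        norm_num at hn
        linarith
      · exact h
    have hn0' : (0 : ℝ) < n := by exact_mod_cast hn0
    have ht2 : (2 : ℝ) ^ t * lam ≤ H := by
      have : 0 ≤ (2 : ℝ) ^ t * lam := by positivity
      rw [pow_succ] at ht
      linarith
    have ih' := ih (fun _ => hb (by omega)) ht2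
    simp only [metaIter, OracleProg.expect_bind, OracleProg.expect]
    have hN : 0 ≤ 48 * σ / (lam * Real.sqrt n) := by positivity
    have h1 := OracleProg.expect_ofReal_affine_le D (oracleAnswer f) (by positivity) ih'
      zero_le_one hN
    simp only [one_mul] at h1
    refine le_trans (OracleProg.expect_mono _ _ (fun xs => ?_) _)
      (h1.trans (ENNReal.ofReal_le_ofReal (le_of_eq (by push_cast; ring))))
    set z := regMin G lam xs t with hz
    set L := H + lam * ∑ k ∈ Icc 1 t, (2 : ℝ) ^ k with hL
    set μ := lam + lam * ∑ k ∈ Icc 1 t, (2 : ℝ) ^ k with hμ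
    have hsum : (∑ k ∈ Icc 1 t, (2 : ℝ) ^ k) = 2 ^ (t + 1) - 2 := sum_Icc_two_pow t
    have hsum0 : 0 ≤ ∑ k ∈ Icc 1 t, (2 : ℝ) ^ k := by positivity
    have hL0 : 0 < L := by positivity
    have hL2 : L ≤ 2 * H := by rw [hL, hsum]; linarith
    have hμl : lam * 2 ^ t ≤ μ := by
      have h2t : (1 : ℝ) ≤ 2 ^ t := one_le_pow₀ (by norm_num)
      rw [hμ, hsum, pow_succ]
      nlinarith
    have hμ0 : 0 < μ := by positivity
    have hlμ : lam ≤ μ := by rw [hμ]; nlinarith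
    -- From `L ≤ 2H`, `lam ≤ μ` and `32 H / lam ≤ n²`.
    have hκ : 4 * L / (μ * n ^ 2) ≤ 1 / 4 := by
      rw [div_le_iff₀ (by positivity)]
      rw [← mul_div_assoc, div_le_iff₀ hl] at hn
      have := mul_le_mul_of_nonneg_right hlμ (by positivity : (0 : ℝ) ≤ n ^ 2)
      nlinarith
    have hsq := expect_acsaSq_le (hG.add_recReg lam xs t) hL0 hμ0
      (regMin_spec hG hl xs t)
      (hA.addKnown hG.differentiable fun x => (hasGradientAt_recReg lam xs t x).differentiableAt)
      hσ (xs t) (hb (by omega)) hn0 hκ (by norm_num)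
    rw [← hz] at hsq
    have hsum1 : 0 ≤ ∑ k ∈ Icc 1 t, 2 ^ k * ‖z - xs k‖ := by positivity
    have h2 := OracleProg.expect_ofReal_affine_le D (oracleAnswer f) (by positivity) hsq
      (by positivity : (0 : ℝ) ≤ 6 * 2 ^ (t + 1)) hsum1
    refine le_trans (OracleProg.expect_mono _ _ (fun y => ENNReal.ofReal_le_ofReal ?_) _)
      (h2.trans (ENNReal.ofReal_le_ofReal ?_))
    · exact (metaPotential_update_le hG hl xs t y).trans_eq (add_comm _ _)
    · have h3 : 6 * 2 ^ (t + 1) * (4 * σ / (μ * Real.sqrt n)) ≤ 48 * σ / (lam * Real.sqrt n) := by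
        have hs0 : 0 < Real.sqrt n := Real.sqrt_pos.2 hn0'
        calc 6 * 2 ^ (t + 1) * (4 * σ / (μ * Real.sqrt n))
            ≤ 6 * 2 ^ (t + 1) * (4 * σ / (lam * 2 ^ t * Real.sqrt n)) := by gcongr
          _ = 48 * σ / (lam * Real.sqrt n) := by rw [pow_succ]; field_simp; ring
      rw [metaPotential, ← hz, mul_add, pow_succ] at *
      linarith

lemma measurable_recReg (lam : ℝ) (t : ℕ) :
    Measurable fun y : (ℕ → Euc d) × Euc d => recReg lam y.1 t y.2 := by
  simp only [recReg]
  fun_prop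

lemma measurable_gradient_recReg (lam : ℝ) (t : ℕ) :
    Measurable fun y : (ℕ → Euc d) × Euc d => gradient (recReg lam y.1 t) y.2 := by
  simp only [fun (y : (ℕ → Euc d) × Euc d) => (hasGradientAt_recReg lam y.1 t y.2).gradient]
  fun_prop

lemma isRegular_metaIter (hA : OracleProg.IsRegular (oracleAnswer f) A 1) (H lam : ℝ)
    (x₀ : Euc d) (b t : ℕ) :
    OracleProg.IsRegular (oracleAnswer f) (fun _ : Unit => metaIter acsaSq H lam A x₀ b t)
      (t * (b / 2 + b / 2)) := by
  induction t with
  | zero => rw [zero_mul]; exact OracleProg.IsRegular.ret measurable_const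
  | succ t ih =>
    rw [Nat.add_mul, one_mul]
    refine ih.bind ?_
    have hB : OracleProg.IsRegular (oracleAnswer f)
        (fun y : (ℕ → Euc d) × Euc d => addKnown (recReg lam y.1 t) A y.2) 1 :=
      isRegular_addKnown (A := fun _ => A) (r := fun xs => recReg lam xs t) (hA.comp measurable_snd) (measurable_recReg lam t)
        (measurable_gradient_recReg lam t)
    have hstep := (isRegular_acsaSq (B := fun xs => addKnown (recReg lam xs t) A)
      (L := H + lam * ∑ k ∈ Icc 1 t, 2 ^ k)
      (μ := lam + lam * ∑ k ∈ Icc 1 t, 2 ^ k) hB b).comp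
      (g := fun y : Unit × (ℕ → Euc d) => (y.2, y.2 t)) (by fun_prop)
    refine OracleProg.IsRegular.bind (q' := 0)
      (k := fun (y : Unit × (ℕ → Euc d)) x => OracleProg.ret (Function.update y.2 (t + 1) x))
      hstep (OracleProg.IsRegular.ret ?_)
    refine measurable_pi_lambda _ fun k => ?_
    rcases eq_or_ne k (t + 1) with rfl | hk
    · simp only [Function.update_self]
      exact measurable_snd
    · simp only [Function.update_of_ne hk]
      fun_prop

end RecursiveRegularization

/-! ### The main theorem -/

/-- The first bound keeps the smoothness within twice the original one in every round; the second
lets the final potential control the gradient. -/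
lemma numRounds_bounds {H lam : ℝ} (hl : 0 < lam) (h : lam ≤ H) :
    2 ^ numRounds H lam * lam ≤ H ∧ H ≤ 2 ^ (numRounds H lam + 1) * lam := by
  have h1 : 1 ≤ H / lam := (one_le_div hl).2 h
  have h0 : 0 < H / lam := by positivity
  constructor
  · rw [← le_div_iff₀ hl, ← Real.rpow_natCast, ← Real.le_logb_iff_rpow_le (by norm_num) h0]
    exact Nat.floor_le (Real.logb_nonneg (by norm_num) h1)
  · rw [← div_le_iff₀ hl, ← Real.rpow_natCast, ← Real.logb_le_iff_le_rpow (by norm_num) h0]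
    push_cast
    exact (Nat.lt_floor_add_one _).le

lemma findsStationary_of_expect_le {d : ℕ} {Z : Type*} [MeasurableSpace Z] {F : Euc d → ℝ}
    {f : Euc d → Z → ℝ} {D : Measure Z} [IsProbabilityMeasure D] {ε : ℝ} {m q : ℕ}
    {p : FOProg d (Euc d)} (hp : OracleProg.IsRegular (oracleAnswer f) (fun _ : Unit => p) q)
    (hqm : q ≤ m) (hF : Measurable (gradient F)) (hε : 0 ≤ ε)
    (h : p.expect D (oracleAnswer f) (fun x => ENNReal.ofReal ‖gradient F x‖)
      ≤ ENNReal.ofReal ε) : FindsStationary F f D ε m p := by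
  have hmeas : Measurable fun ω : ℕ → Z => ‖gradient F (p.run (oracleAnswer f) ω 0).1‖ :=
    (hF.comp ((hp.measurable 0).comp (measurable_prodMk_left (x := ())))).norm
  have hle := (OracleProg.lintegral_run_le_expect D (oracleAnswer f)
    (fun x => ENNReal.ofReal ‖gradient F x‖) p).trans h
  have hnn : ∀ ω : ℕ → Z, 0 ≤ ‖gradient F (p.run (oracleAnswer f) ω 0).1‖ :=
    fun ω => norm_nonneg _
  have hint : Integrable (fun ω : ℕ → Z => ‖gradient F (p.run (oracleAnswer f) ω 0).1‖)
      (Measure.infinitePi fun _ : ℕ => D) := by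
    refine ⟨hmeas.aestronglyMeasurable, ?_⟩
    rw [hasFiniteIntegral_iff_ofReal (Filter.Eventually.of_forall hnn)]
    exact hle.trans_lt ENNReal.ofReal_lt_top
  refine ⟨fun ω => ?_, hint, ?_⟩
  · rw [hp.count () ω 0]; omega
  · rw [← ofReal_integral_eq_lintegral_ofReal hint (Filter.Eventually.of_forall hnn)] at hle
    exact (ENNReal.ofReal_le_ofReal_iff hε).1 hle

/-- For the minimizer `z` of `G`, `lam ‖x - z‖ ≤ ‖∇G(x)‖`, so `‖∇F(x)‖ ≤ 2 ‖∇G(x)‖ + lam ‖x₀ - z‖`.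
The expected total is at most `7 lam ‖x₀ - z‖ + 96 T σ / √n`; the constants `14` and `192` make each
part at most `ε / 2`. -/
lemma findsStationary_regularizedAlgorithm {d : ℕ} {H lam σ ε : ℝ} (hH : 0 < H) (hl : 0 < lam)
    (hσ : 0 ≤ σ) (hε : 0 < ε) {x₀ : Euc d} {F : Euc d → ℝ} (hF : SmoothStronglyConvex H 0 F)
    (hdist : ∀ z : Euc d, (∀ y, F z + lam / 2 * ‖z - x₀‖ ^ 2 ≤ F y + lam / 2 * ‖y - x₀‖ ^ 2) →
      14 * (lam * ‖x₀ - z‖) ≤ ε)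
    {n : ℕ} (hn : 32 * ((H + lam) / lam) ≤ n ^ 2)
    (hn' : (192 * numRounds (H + lam) lam * (σ / ε)) ^ 2 ≤ n)
    {Z : Type*} [MeasurableSpace Z] {f : Euc d → Z → ℝ} {D : Measure Z}
    [IsProbabilityMeasure D] (hf : IsStochasticOracle F σ f D) :
    FindsStationary F f D ε (2 * n * numRounds (H + lam) lam)
      (regularizedAlgorithm H lam x₀ (2 * n * numRounds (H + lam) lam)) := by
  set T := numRounds (H + lam) lam with hT
  set G : Euc d → ℝ := fun x => F x + lam / 2 * ‖x - x₀‖ ^ 2 with hGdef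
  have hG : SmoothStronglyConvex (H + lam) lam G := by
    have := hF.add_sq (lam / 2) x₀
    rwa [mul_div_cancel₀ lam two_ne_zero, zero_add] at this
  have hH' : 0 < H + lam := by linarith
  have hn0 : (0 : ℝ) < n := by
    rcases Nat.eq_zero_or_pos n with h | h
    · rw [h] at hn
      have : 0 < (H + lam) / lam := by positivity
      norm_num at hn
      linarith
    · exact_mod_cast h
  obtain ⟨hT1, hT2⟩ := numRounds_bounds hl (by linarith : lam ≤ H + lam)
  rw [← hT] at hT1 hT2
  have hr : ∀ x, HasGradientAt (fun x => lam / 2 * ‖x - x₀‖ ^ 2) (lam • (x - x₀)) x := fun x => by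
    have := hasGradientAt_mul_norm_sub_sq (lam / 2) x₀ x
    rwa [mul_div_cancel₀ lam two_ne_zero] at this
  set A : Euc d → FOProg d (ℝ × Euc d) :=
    addKnown (fun x => lam / 2 * ‖x - x₀‖ ^ 2) askOracle with hAdef
  have hA : NoisyGradient D f σ G A :=
    (noisyGradient_askOracle hf hF.differentiable).addKnown hF.differentiable
      fun x => (hr x).differentiableAt
  have hAreg : OracleProg.IsRegular (oracleAnswer f) A 1 := by
    have h1 := isRegular_addKnown (S := Unit) (f := f) (A := fun _ => askOracle)
      (r := fun _ x => lam / 2 * ‖x - x₀‖ ^ 2) ((isRegular_askOracle hf).comp measurable_snd)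
      (by fun_prop) (by simp only [fun x => (hr x).gradient]; fun_prop)
    exact h1.comp (g := fun x : Euc d => ((), x)) (by fun_prop)
  set b := 2 * n * T / T with hb
  have hbn : 0 < T → b / 2 = n := fun h => by
    rw [hb, Nat.mul_div_cancel _ h, Nat.mul_div_cancel_left _ two_pos]
  set p := regularizedAlgorithm H lam x₀ (2 * n * T) with hp
  have hp' : p = (metaIter acsaSq (H + lam) lam A x₀ b T).bind fun xs => .ret (xs T) := rfl
  have hreg : OracleProg.IsRegular (oracleAnswer f) (fun _ : Unit => p)
      (T * (b / 2 + b / 2) + 0) := by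
    rw [hp']
    exact (isRegular_metaIter hAreg (H + lam) lam x₀ b T).bind
      (OracleProg.IsRegular.ret (by fun_prop))
  refine findsStationary_of_expect_le hreg ?_ (hF.continuous_gradient hH le_rfl).measurable hε.le ?_
  · rcases Nat.eq_zero_or_pos T with h | h
    · simp [h]
    · rw [hbn h]; exact le_of_eq (by ring)
  set z := regMin G lam (fun _ => x₀) 0 with hz
  have hzmin : ∀ y, G z ≤ G y := fun y => by
    simpa [recReg_zero] using regMin_spec hG hl (fun _ => x₀) 0 y
  have hδ := hdist z hzmin
  have h1 := expect_metaIter_le hG hl hH' hσ hA x₀ T hbn hn hT1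
  rw [← hz] at h1
  have h2 := OracleProg.expect_ofReal_affine_le D (oracleAnswer f) (by positivity) h1
    (by positivity : 0 ≤ 2 * lam) (by positivity : 0 ≤ lam * ‖x₀ - z‖)
  rw [hp']
  simp only [OracleProg.expect_bind, OracleProg.expect]
  refine le_trans (OracleProg.expect_mono _ _ (fun xs => ENNReal.ofReal_le_ofReal ?_) _)
    (h2.trans (ENNReal.ofReal_le_ofReal ?_))
  · set x := xs T
    have h3 : gradient G x = gradient F x + lam • (x - x₀) :=
      ((hF.hasGradientAt x).add_fun (hr x)).gradient
    have h4 : gradient F x = gradient G x - lam • (x - x₀) := by rw [h3]; abel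
    have h5 : ‖x - x₀‖ ≤ ‖x - z‖ + ‖x₀ - z‖ := by
      rw [norm_sub_rev x₀ z, ← sub_add_sub_cancel x z x₀]; exact norm_add_le _ _
    have h6 := hG.mul_norm_sub_le x z
    rw [gradient_eq_zero_of_forall_le hzmin, sub_zero] at h6
    have h7 : ‖gradient F x‖ ≤ ‖gradient G x‖ + lam * ‖x - x₀‖ := by
      rw [h4]
      refine (norm_sub_le _ _).trans ?_
      rw [norm_smul, Real.norm_of_nonneg hl.le]
    have h8 := norm_gradient_le_metaPotential hG hl hH' hT2 xs
    have h9 := mul_le_mul_of_nonneg_left h5 hl.le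
    linarith
  · have hs0 : 0 < Real.sqrt n := Real.sqrt_pos.2 hn0
    have h3 : 192 * T * (σ / ε) ≤ Real.sqrt n := Real.le_sqrt_of_sq_le hn'
    have h4 : 192 * T * σ / Real.sqrt n ≤ ε := by
      rw [div_le_iff₀ hs0]
      have h5 := mul_le_mul_of_nonneg_left h3 hε.le
      have h6 : ε * (192 * T * (σ / ε)) = 192 * T * σ := by field_simp
      linarith
    have h5 : 2 * lam * (T * (48 * σ / (lam * Real.sqrt n))) = 192 * T * σ / Real.sqrt n / 2 := by
      field_simp; ring
    have h6 : 2 * lam * (3 * ‖x₀ - z‖ + T * (48 * σ / (lam * Real.sqrt n)))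
        = 6 * (lam * ‖x₀ - z‖) + 192 * T * σ / Real.sqrt n / 2 := by
      rw [mul_add, h5]; ring
    linarith

/-- The guarantee of the algorithm in terms of `ρ`, which is `R / ε` for domain-bounded
functions and `Δ / ε ^ 2` for range-bounded functions. -/
lemma exists_budget {H ρ σ ε lam : ℝ} (hH : 0 < H) (hρ : 0 < ρ) (hσ : 0 ≤ σ) (hε : 0 < ε)
    (hlam : lam = 1 / 400 * (max ρ (σ ^ 4 * logp (σ / ε) ^ 4 / (H * ε ^ 4)))⁻¹) :
    ∃ m : ℕ, (m : ℝ) ≤ 10 ^ 12 * (Real.sqrt (H * ρ) * logp (Real.sqrt (H * ρ))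
        + σ ^ 2 / ε ^ 2 * logp (σ / ε) ^ 3) ∧
      ∀ (d : ℕ) (x₀ : Euc d) (F : Euc d → ℝ), SmoothStronglyConvex H 0 F →
        (∀ z : Euc d, (∀ y, F z + lam / 2 * ‖z - x₀‖ ^ 2 ≤ F y + lam / 2 * ‖y - x₀‖ ^ 2) →
          14 * (lam * ‖x₀ - z‖) ≤ ε) →
        ∀ (Z : Type*) [MeasurableSpace Z] (f : Euc d → Z → ℝ) (D : Measure Z)
          [IsProbabilityMeasure D], IsStochasticOracle F σ f D →
          FindsStationary F f D ε m (regularizedAlgorithm H lam x₀ m) := by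
  set M := max ρ (σ ^ 4 * logp (σ / ε) ^ 4 / (H * ε ^ 4)) with hM
  have hM0 : 0 < M := lt_of_lt_of_le hρ (le_max_left _ _)
  have hl : 0 < lam := by rw [hlam]; positivity
  have hs : 0 ≤ σ / ε := by positivity
  have hQ : (H + lam) / lam
      -- With this choice of `lam` the condition number depends only on `H * ρ` and `σ / ε`.
      = 1 + 400 * max (H * ρ) ((σ / ε) ^ 4 * logp (σ / ε) ^ 4) := by
    have h1 : (σ / ε) ^ 4 * logp (σ / ε) ^ 4
        = H * (σ ^ 4 * logp (σ / ε) ^ 4 / (H * ε ^ 4)) := by field_simp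
    rw [h1, ← mul_max_of_nonneg _ _ hH.le, ← hM, hlam]
    field_simp
    ring
  have hbudget := budget_le (n := ⌈Real.sqrt (32 * ((H + lam) / lam))⌉₊
    + ⌈(192 * (numRounds (H + lam) lam : ℝ) * (σ / ε)) ^ 2⌉₊ + 1) (mul_pos hH hρ) hs hQ
    (T := numRounds (H + lam) lam) rfl rfl
  set n := ⌈Real.sqrt (32 * ((H + lam) / lam))⌉₊
    + ⌈(192 * (numRounds (H + lam) lam : ℝ) * (σ / ε)) ^ 2⌉₊ + 1 with hn
  refine ⟨2 * n * numRounds (H + lam) lam, by rwa [div_pow] at hbudget,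
    fun d x₀ F hF hdist Z _ f D _ hf =>
      findsStationary_regularizedAlgorithm hH hl hσ hε hF hdist ?_ ?_ hf⟩
  · have h1 : Real.sqrt (32 * ((H + lam) / lam)) ≤ n :=
      (Nat.le_ceil _).trans (Nat.cast_le.2 (by omega))
    exact (Real.sqrt_le_left (by positivity)).1 h1
  · exact (Nat.le_ceil _).trans (Nat.cast_le.2 (by omega))

lemma logp_sqrt_le {x : ℝ} (hx : 0 ≤ x) : logp (Real.sqrt x) ≤ logp x := by
  rw [logp, Real.log_sqrt hx]
  refine max_le (one_le_logp x) ?_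
  have h1 := one_le_logp x
  have h2 := log_le_logp x
  linarith

/-- The minimum defining `lam` is written as the inverse of a maximum of inverses, so that `σ = 0`
contributes the entry `0` instead of an infinite one. -/
theorem mainTheorem2 :
    (∃ c C : ℝ, 0 < c ∧ 0 < C ∧
      ∀ H R σ ε : ℝ, 0 < H → 0 < R → 0 ≤ σ → 0 < ε →
        ∃ lam : ℝ, ∃ m : ℕ,
          lam = c * (max (R / ε) (σ ^ 4 * logp (σ / ε) ^ 4 / (H * ε ^ 4)))⁻¹ ∧
          (m : ℝ) ≤ C * (Real.sqrt (H * R / ε) * logp (H * R / ε)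
            + σ ^ 2 / ε ^ 2 * logp (σ / ε) ^ 3) ∧
          ∀ (d : ℕ) (x₀ : Euc d) (F : Euc d → ℝ), DomainBounded H 0 R x₀ F →
            ∀ (Z : Type*) [MeasurableSpace Z] (f : Euc d → Z → ℝ) (D : Measure Z)
              [IsProbabilityMeasure D], IsStochasticOracle F σ f D →
              FindsStationary F f D ε m (regularizedAlgorithm H lam x₀ m)) ∧
    (∃ c C : ℝ, 0 < c ∧ 0 < C ∧
      ∀ H Δ σ ε : ℝ, 0 < H → 0 < Δ → 0 ≤ σ → 0 < ε →
        ∃ lam : ℝ, ∃ m : ℕ,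
          lam = c * (max (Δ / ε ^ 2) (σ ^ 4 * logp (σ / ε) ^ 4 / (H * ε ^ 4)))⁻¹ ∧
          (m : ℝ) ≤ C * (Real.sqrt (H * Δ) / ε * logp (Real.sqrt (H * Δ) / ε)
            + σ ^ 2 / ε ^ 2 * logp (σ / ε) ^ 3) ∧
          ∀ (d : ℕ) (x₀ : Euc d) (F : Euc d → ℝ), RangeBounded H 0 Δ x₀ F →
            ∀ (Z : Type*) [MeasurableSpace Z] (f : Euc d → Z → ℝ) (D : Measure Z)
              [IsProbabilityMeasure D], IsStochasticOracle F σ f D →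
              FindsStationary F f D ε m (regularizedAlgorithm H lam x₀ m)) := by
  have hlam_le : ∀ ρ B : ℝ, 0 < ρ → 1 / 400 * (max ρ B)⁻¹ ≤ 1 / 400 * ρ⁻¹ := fun ρ B h => by
    have := inv_anti₀ h (le_max_left ρ B)
    linarith
  refine ⟨⟨1 / 400, 10 ^ 12, by norm_num, by norm_num, fun H R σ ε hH hR hσ hε => ?_⟩,
    ⟨1 / 400, 10 ^ 12, by norm_num, by norm_num, fun H Δ σ ε hH hΔ hσ hε => ?_⟩⟩
  · have hρ : 0 < R / ε := by positivity
    obtain ⟨m, hm, hfind⟩ := exists_budget hH hρ hσ hε rfl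
    refine ⟨_, m, rfl, ?_, fun d x₀ F hF => hfind d x₀ F hF.1 fun z hz => ?_⟩
    · rw [← mul_div_assoc] at hm
      refine hm.trans ?_
      have := logp_sqrt_le (by positivity : 0 ≤ H * R / ε)
      gcongr
    · obtain ⟨-, xs, hxs, hR'⟩ := hF
      have hle := hlam_le (R / ε) (σ ^ 4 * logp (σ / ε) ^ 4 / (H * ε ^ 4)) hρ
      set lam := 1 / 400 * (max (R / ε) (σ ^ 4 * logp (σ / ε) ^ 4 / (H * ε ^ 4)))⁻¹ with hlam
      have hl : 0 < lam := by
        have := lt_of_lt_of_le hρ (le_max_left (R / ε) (σ ^ 4 * logp (σ / ε) ^ 4 / (H * ε ^ 4)))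
        rw [hlam]; positivity
      -- As `xs` minimizes `F` and `z` the regularized function, `z` is no farther from `x₀` than
      -- `xs`.
      have h1 : lam / 2 * ‖z - x₀‖ ^ 2 ≤ lam / 2 * ‖xs - x₀‖ ^ 2 := by
        linarith [hz xs, hxs z]
      have h2 : ‖x₀ - z‖ ≤ R := by
        rw [norm_sub_rev] at hR' ⊢
        exact (le_of_sq_le_sq (le_of_mul_le_mul_left h1 (by positivity)) (norm_nonneg _)).trans hR'
      have h3 : lam * ‖x₀ - z‖ ≤ 1 / 400 * (R / ε)⁻¹ * R :=
        mul_le_mul hle h2 (norm_nonneg _) (by positivity)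
      have h4 : 1 / 400 * (R / ε)⁻¹ * R = ε / 400 := by field_simp
      linarith
  · have hρ : 0 < Δ / ε ^ 2 := by positivity
    obtain ⟨m, hm, hfind⟩ := exists_budget hH hρ hσ hε rfl
    refine ⟨_, m, rfl, ?_, fun d x₀ F hF => hfind d x₀ F hF.1 fun z hz => ?_⟩
    · rwa [← mul_div_assoc, Real.sqrt_div (by positivity), Real.sqrt_sq hε.le] at hm
    · obtain ⟨-, xs, hxs, hΔ'⟩ := hF
      have hle := hlam_le (Δ / ε ^ 2) (σ ^ 4 * logp (σ / ε) ^ 4 / (H * ε ^ 4)) hρ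
      set lam := 1 / 400 * (max (Δ / ε ^ 2) (σ ^ 4 * logp (σ / ε) ^ 4 / (H * ε ^ 4)))⁻¹ with hlam
      have hl : 0 < lam := by
        have := lt_of_lt_of_le hρ
          (le_max_left (Δ / ε ^ 2) (σ ^ 4 * logp (σ / ε) ^ 4 / (H * ε ^ 4)))
        rw [hlam]; positivity
      have h1 : lam / 2 * ‖x₀ - z‖ ^ 2 ≤ Δ := by
        have h2 := hz x₀
        rw [sub_self, norm_zero, norm_sub_rev] at h2
        have := hxs z
        norm_num at h2
        linarith
      have h2 : lam * Δ ≤ ε ^ 2 / 400 := by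
        have h3 := mul_le_mul_of_nonneg_right hle hΔ.le
        have h4 : 1 / 400 * (Δ / ε ^ 2)⁻¹ * Δ = ε ^ 2 / 400 := by field_simp
        linarith
      -- The constant `400` comes from here: the square is at most `196 * 2 * lam * Δ ≤ 392/400 *
      -- ε²`.
      have h3 : (14 * (lam * ‖x₀ - z‖)) ^ 2 ≤ ε ^ 2 := by
        have h4 := mul_le_mul_of_nonneg_left h1 hl.le
        nlinarith
      exact le_of_sq_le_sq h3 hε.le

end
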